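/- **Theorem (Uniqueness of the AT Inferential Framework).** Let $\mathfrak A=\mathbb C\oplus\mathbb H\oplus M_3(\mathbb C)$, regarded as a real $*$-algebra, and let $\pi:\mathfrak A\to\mathcal B(\mathcal H)$ be a faithful unital real $*$-representation on a finite-dimensional complex Hilbert space $\mathcal H$ with $\dim_{\mathbb C}\mathcal H\ge 3$, in which the two complex summands are represented by complex algebras, i.e. $\pi(S)+i\,\pi(S)=\pi(S)$ for $S=\mathbb C$ and $S=M_3(\mathbb C)$. Let $P_1,P_2,P_3$ be the minimal projections of the boundary algebra $Z(\pi(\mathfrak A)+i\,\pi(\mathfrak A))$, the center of the complex envelope; there are exactly three of them. Let $\mathcal P(\mathcal H)$ be the lattice of orthogonal projections of $\mathcal H$. A *coherent valuation* is a linear functional $V:\mathbb R^{\{1,2,3\}}\to\mathbb R$ with $V(f)\ge 0$ for $f\ge 0$ and $V(\mathbf 1)=1$. An *epistemic state* is a map $p:\mathcal P(\mathcal H)\to[0,1]$ such that $p(\mathbf I)=1$; $p\big(\sum_kP_k'\big)=\sum_k p(P_k')$ for every finite family of pairwise orthogonal projections $P_k'$ with sum $\mathbf I$; and, for some coherent valuation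 $V$, $p\big(\sum_{\alpha\in S}P_\alpha\big)=\sum_{\alpha\in S}V(e_\alpha)$ for all $S\subseteq\{1,2,3\}$, where $e_\alpha$ is the indicator of $\alpha$. (Noncontextuality is the fact that $p$ is a function of the projection alone.) A *framework* assigns to every unitary $U$ on $\mathcal H$ a map $p\mapsto p^U$ of epistemic states to epistemic states, and to every $\alpha$ and every epistemic state $p$ with $p(P_\alpha)>0$ an epistemic state $p_\alpha$. It is *compatible* if * (unitary ontological evolution $\psi\mapsto U\psi$) $p^U(Q)=p(R)$ whenever the event $Q$ after the evolution is the same as the event $R$ before it, that is, whenever for all $\psi\in\mathcal H$: $\psi\in\operatorname{ran}R\iff U\psi\in\operatorname{ran}Q$; * (Bayesian conditioning on the boundary event $\alpha$) $p_\alpha(P_\alpha)=1$ and $p_\alpha(Q)=p(Q)/p(P_\alpha)$ for every projection $Q\le P_\alpha$. Then: 1. (Born rule) For every epistemic state $p$ there is a unique density operator $\rho$ ($\rho\ge 0$, $\operatorname{Tr}\rho=1$) with $p(Q)=\operatorname{Tr}(\rho\,Q)$ for all $Q\in\mathcal P(\mathcal H)$; conversely every density operator represents in this way exactly one epistemic state.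 2. There is exactly one compatible framework. 3. A framework is compatible if and only if, for every epistemic state $p$ with density operator $\rho$, the state $p^U$ has density operator $U\rho U^\dagger$ for every unitary $U$, and, for each $\alpha$ with $p(P_\alpha)>0$, the state $p_\alpha$ has density operator $P_\alpha\rho P_\alpha/\operatorname{Tr}(\rho P_\alpha)$. -/

import Mathlib

open scoped Quaternion

/-- The foundational real `*`-algebra `ℂ ⊕ ℍ ⊕ M₃(ℂ)`. -/
abbrev FoundationalAlgebra : Type := ℂ × ℍ[ℝ] × Matrix (Fin 3) (Fin 3) ℂ

section Aperture

variable {H : Type*} [NormedAddCommGroup H] [InnerProductSpace ℂ H] [FiniteDimensional ℂ H]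

/-- A faithful (unital) `*`-representation of the real `*`-algebra `ℂ ⊕ ℍ ⊕ M₃(ℂ)` on a
finite-dimensional complex Hilbert space, in which the two complex summands `ℂ` and `M₃(ℂ)` are
represented by complex algebras of operators: `π(S) + i π(S) = π(S)` for these two summands `S`. -/
structure ATRepresentation (H : Type*) [NormedAddCommGroup H] [InnerProductSpace ℂ H]
    [FiniteDimensional ℂ H] where
  /-- the representation -/
  π : FoundationalAlgebra →⋆ₐ[ℝ] (H →ₗ[ℂ] H)
  faithful : Function.Injective π
  complex_fst : ∀ z : ℂ, ∃ w : ℂ, Complex.I • π (z, 0, 0) = π (w, 0, 0)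
  complex_thd : ∀ m : Matrix (Fin 3) (Fin 3) ℂ, ∃ n : Matrix (Fin 3) (Fin 3) ℂ,
    Complex.I • π (0, 0, m) = π (0, 0, n)

/-- The complex envelope `π(𝔄) + i π(𝔄)` of the represented algebra. -/
def ATRepresentation.envelope (R : ATRepresentation H) : Set (H →ₗ[ℂ] H) :=
  {T | ∃ a b : FoundationalAlgebra, T = R.π a + Complex.I • R.π b}

/-- The boundary algebra: the center of the complex envelope. -/
def ATRepresentation.boundaryAlgebra (R : ATRepresentation H) : Set (H →ₗ[ℂ] H) :=
  {T | T ∈ R.envelope ∧ ∀ S ∈ R.envelope, T * S = S * T}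

/-- The lattice of (orthogonal) projections of `H`, as a type. -/
abbrev Projection (H : Type*) [NormedAddCommGroup H] [InnerProductSpace ℂ H]
    [FiniteDimensional ℂ H] : Type _ :=
  {Q : H →ₗ[ℂ] H // IsStarProjection Q}

/-- `Q` is a minimal central projection: a nonzero projection of the boundary algebra such that
every nonzero projection of the boundary algebra below it is equal to it. -/
def ATRepresentation.IsMinimalCentral (R : ATRepresentation H) (Q : Projection H) : Prop :=
  Q.1 ∈ R.boundaryAlgebra ∧ Q.1 ≠ 0 ∧
    ∀ Q' : Projection H, Q'.1 ∈ R.boundaryAlgebra → Q'.1 ≠ 0 → Q.1 * Q'.1 = Q'.1 → Q' = Q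

/-- `P₀, P₁, P₂` is a labelling without repetition of the minimal central projections, that is,
of the primitive outcomes of the Aperture. -/
def ATRepresentation.IsSectorLabelling (R : ATRepresentation H) (P : Fin 3 → Projection H) :
    Prop :=
  Function.Injective P ∧ ∀ Q : Projection H, R.IsMinimalCentral Q ↔ ∃ α, Q = P α

/-- The unit of one of the three simple summands of `ℂ ⊕ ℍ ⊕ M₃(ℂ)`. -/
noncomputable def summandUnit (α : Fin 3) : FoundationalAlgebra :=
  (if α = 0 then 1 else 0, if α = 1 then 1 else 0, if α = 2 then 1 else 0)

theorem summandUnit_mul_self (α : Fin 3) : summandUnit α * summandUnit α = summandUnit α := by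
  fin_cases α <;> simp [summandUnit]

theorem star_summandUnit (α : Fin 3) : star (summandUnit α) = summandUnit α := by
  fin_cases α <;> simp [summandUnit, Prod.ext_iff]

theorem summandUnit_comm (α : Fin 3) (a : FoundationalAlgebra) :
    summandUnit α * a = a * summandUnit α := by
  fin_cases α <;> simp [summandUnit, Prod.ext_iff]

theorem sum_summandUnit : ∑ α, summandUnit α = 1 := by
  simp [summandUnit, Fin.sum_univ_three, Prod.ext_iff]

/-- The operator by which the unit of a simple summand acts: the projection onto its sector. -/
noncomputable def ATRepresentation.sectorProjection (R : ATRepresentation H) (α : Fin 3) :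
    Projection H :=
  ⟨R.π (summandUnit α), by
    constructor
    · rw [IsIdempotentElem, ← map_mul, summandUnit_mul_self]
    · rw [IsSelfAdjoint, ← map_star, star_summandUnit]⟩

theorem ATRepresentation.sectorProjection_mem (R : ATRepresentation H) (α : Fin 3) :
    (R.sectorProjection α).1 ∈ R.boundaryAlgebra := by
  refine ⟨⟨summandUnit α, 0, by simp [sectorProjection]⟩, ?_⟩
  rintro _ ⟨a, b, rfl⟩
  simp only [sectorProjection, mul_add, add_mul, mul_smul_comm, smul_mul_assoc, ← map_mul,
    summandUnit_comm]

theorem ATRepresentation.sectorProjection_ne_zero (R : ATRepresentation H) (α : Fin 3) :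
    (R.sectorProjection α).1 ≠ 0 := by
  intro h
  have h2 : summandUnit α = 0 := R.faithful (by simpa [sectorProjection] using h)
  revert h2
  fin_cases α <;> simp [summandUnit, Prod.ext_iff]

theorem complex_scalar_of_sq {z w : ℂ} (hw : w * w = -1) :
    ∃ x y : ℝ, z = x + y * w := by
  have h : (w - Complex.I) * (w + Complex.I) = 0 := by
    linear_combination hw - Complex.I_mul_I
  rcases mul_eq_zero.1 h with h | h
  · refine ⟨z.re, z.im, ?_⟩
    rw [sub_eq_zero.1 h, Complex.re_add_im]
  · refine ⟨z.re, -z.im, ?_⟩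
    rw [eq_neg_of_add_eq_zero_left h]
    conv_lhs => rw [← Complex.re_add_im z]
    push_cast
    ring

theorem quaternion_real_of_comm {x : ℍ[ℝ]} (hx : ∀ q : ℍ[ℝ], x * q = q * x) :
    ∃ r : ℝ, x = r • (1 : ℍ[ℝ]) := by
  obtain ⟨i, hi⟩ : ∃ i : ℍ[ℝ], i = ⟨0, 1, 0, 0⟩ := ⟨_, rfl⟩
  obtain ⟨j, hj⟩ : ∃ j : ℍ[ℝ], j = ⟨0, 0, 1, 0⟩ := ⟨_, rfl⟩
  have h1 : (x * i).imJ = (i * x).imJ := by rw [hx]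
  have h2 : (x * i).imK = (i * x).imK := by rw [hx]
  have h3 : (x * j).imK = (j * x).imK := by rw [hx]
  refine ⟨x.re, ?_⟩
  rw [Quaternion.imJ_mul, Quaternion.imJ_mul] at h1
  rw [Quaternion.imK_mul, Quaternion.imK_mul] at h2 h3
  simp only [hi, hj, mul_zero, zero_mul, mul_one, one_mul] at h1 h2 h3
  ext <;> simp <;> linarith

theorem matrix_scalar_of_comm {m : Matrix (Fin 3) (Fin 3) ℂ}
    (hm : ∀ n : Matrix (Fin 3) (Fin 3) ℂ, m * n = n * m) :
    ∃ z : ℂ, m = z • (1 : Matrix (Fin 3) (Fin 3) ℂ) := by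
  obtain ⟨z, hz⟩ := Matrix.mem_range_scalar_of_commute_single (M := m)
    (fun i j _ => (hm _).symm)
  exact ⟨z, by rw [← hz, Matrix.scalar_apply, Matrix.smul_one_eq_diagonal]⟩

theorem ATRepresentation.map_real_smul (R : ATRepresentation H) (r : ℝ) (a : FoundationalAlgebra) :
    R.π (r • a) = (r : ℂ) • R.π a := by
  rw [map_smul]
  ext ψ
  simp

theorem ATRepresentation.quaternion_indep (R : ATRepresentation H) {u v : ℍ[ℝ]}
    (h : R.π (0, u, 0) + Complex.I • R.π (0, v, 0) = 0) : u = 0 ∧ v = 0 := by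
  have hv : v = 0 := by
    by_contra hv
    have h1 : R.π (0, u * v⁻¹, 0) + Complex.I • R.π (0, 1, 0) = 0 := by
      have h2 := congrArg (· * R.π (0, v⁻¹, 0)) h
      simpa [add_mul, smul_mul_assoc, ← map_mul, mul_inv_cancel₀ hv] using h2
    have h3 : ∀ q : ℍ[ℝ], (u * v⁻¹) * q = q * (u * v⁻¹) := by
      intro q
      have h4 := congrArg (· * R.π (0, q, 0)) h1
      have h5 := congrArg (R.π (0, q, 0) * ·) h1
      simp only [add_mul, mul_add, smul_mul_assoc, mul_smul_comm, ← map_mul, Prod.mk_mul_mk,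
        mul_zero, zero_mul, one_mul, mul_one] at h4 h5
      have h6 := R.faithful (add_right_cancel (h4.trans h5.symm))
      simpa using h6
    obtain ⟨r, hr⟩ := quaternion_real_of_comm h3
    have h7 : R.π (0, u * v⁻¹, 0) = (r : ℂ) • R.π (0, 1, 0) := by
      rw [← R.map_real_smul, hr]
      simp
    rw [h7, ← add_smul] at h1
    rcases smul_eq_zero.1 h1 with h8 | h8
    · have := congrArg Complex.im h8
      simp at this
    · have : ((0, 1, 0) : FoundationalAlgebra) = 0 := R.faithful (by simpa using h8)
      simp [Prod.ext_iff] at this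
  subst hv
  have hu : ((0, u, 0) : FoundationalAlgebra) = 0 := R.faithful (by
    have h0 : ((0, 0, 0) : FoundationalAlgebra) = 0 := rfl
    simpa [h0] using h)
  exact ⟨by simpa [Prod.ext_iff] using hu, rfl⟩

theorem ATRepresentation.boundary_scalar (R : ATRepresentation H) (α : Fin 3) {T : H →ₗ[ℂ] H}
    (hT : T ∈ R.boundaryAlgebra) :
    ∃ c : ℂ, (R.sectorProjection α).1 * T = c • (R.sectorProjection α).1 := by
  obtain ⟨⟨a, b, rfl⟩, hc⟩ := hT
  have hcomm : ∀ d : FoundationalAlgebra, (R.π a + Complex.I • R.π b) * R.π d =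
      R.π d * (R.π a + Complex.I • R.π b) := fun d => hc _ ⟨d, 0, by simp⟩
  have hP : (R.sectorProjection α).1 * (R.π a + Complex.I • R.π b) =
      R.π (summandUnit α * a) + Complex.I • R.π (summandUnit α * b) := by
    simp [sectorProjection, mul_add]
  have hcomm' : ∀ d : FoundationalAlgebra,
      (R.π (summandUnit α * a) + Complex.I • R.π (summandUnit α * b)) * R.π d =
      R.π d * (R.π (summandUnit α * a) + Complex.I • R.π (summandUnit α * b)) := by
    intro d
    rw [← hP, mul_assoc, hcomm, ← mul_assoc, ← mul_assoc,
      (R.sectorProjection_mem α).2 (R.π d) ⟨d, 0, by simp⟩]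
  rw [hP]
  have hI : Complex.I * Complex.I = -1 := Complex.I_mul_I
  fin_cases α
  · have hu : ∀ d : FoundationalAlgebra, summandUnit 0 * d = (d.1, 0, 0) := by
      intro d; simp [summandUnit, Prod.ext_iff]
    have hu1 : summandUnit 0 = (1, 0, 0) := by simp [summandUnit]
    simp only [Fin.zero_eta, hu, sectorProjection]
    simp only [hu1]
    obtain ⟨w, hw⟩ := R.complex_fst b.1
    obtain ⟨j, hj⟩ := R.complex_fst 1
    have hjj : j * j = -1 := by
      have h1 : R.π (j * j, 0, 0) = R.π (-1, 0, 0) := by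
        have h2 : R.π (j * j, 0, 0) = R.π (j, 0, 0) * R.π (j, 0, 0) := by
          rw [← map_mul]; simp
        have h3 : ((-1, 0, 0) : FoundationalAlgebra) = -(1, 0, 0) := by simp
        have h4 : R.π (1, 0, 0) * R.π (1, 0, 0) = R.π (1, 0, 0) := by
          rw [← map_mul]; simp
        rw [h2, ← hj, h3, map_neg, smul_mul_smul_comm, h4, hI, neg_one_smul]
      simpa using R.faithful h1
    obtain ⟨x, y, hz⟩ := complex_scalar_of_sq (z := a.1 + w) hjj
    refine ⟨x + y * Complex.I, ?_⟩
    have h5 : ((a.1, 0, 0) + (w, 0, 0) : FoundationalAlgebra) =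
        x • ((1, 0, 0) : FoundationalAlgebra) + y • ((j, 0, 0) : FoundationalAlgebra) := by
      simp [hz]
    rw [hw, ← map_add, h5, map_add, R.map_real_smul, R.map_real_smul, ← hj, smul_smul, add_smul]
  · have hu : ∀ d : FoundationalAlgebra, summandUnit 1 * d = (0, d.2.1, 0) := by
      intro d; simp [summandUnit, Prod.ext_iff]
    have hu1 : summandUnit 1 = (0, 1, 0) := by simp [summandUnit]
    simp only [Fin.mk_one, hu, sectorProjection] at hcomm' ⊢
    simp only [hu1]
    have h1 : ∀ q : ℍ[ℝ], a.2.1 * q - q * a.2.1 = 0 ∧ b.2.1 * q - q * b.2.1 = 0 := by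
      intro q
      apply R.quaternion_indep
      have h2 := sub_eq_zero.2 (hcomm' (0, q, 0))
      have h3 : ∀ c : ℍ[ℝ], R.π (0, c * q - q * c, 0) =
          R.π (0, c, 0) * R.π (0, q, 0) - R.π (0, q, 0) * R.π (0, c, 0) := by
        intro c
        rw [← map_mul, ← map_mul, ← map_sub]
        simp
      rw [h3, h3, ← h2]
      simp only [add_mul, mul_add, smul_mul_assoc, mul_smul_comm, smul_sub]
      abel
    obtain ⟨x, hx⟩ := quaternion_real_of_comm fun q => sub_eq_zero.1 (h1 q).1
    obtain ⟨y, hy⟩ := quaternion_real_of_comm fun q => sub_eq_zero.1 (h1 q).2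
    refine ⟨x + Complex.I * y, ?_⟩
    have h4 : ∀ r : ℝ, R.π (0, r • (1 : ℍ[ℝ]), 0) = (r : ℂ) • R.π (0, 1, 0) := by
      intro r
      rw [← R.map_real_smul]
      simp
    rw [hx, hy, h4, h4, smul_smul, add_smul]
  · have hu : ∀ d : FoundationalAlgebra, summandUnit 2 * d = (0, 0, d.2.2) := by
      intro d; simp [summandUnit, Prod.ext_iff]
    have hu1 : summandUnit 2 = (0, 0, 1) := by simp [summandUnit]
    simp only [Fin.reduceFinMk, hu, sectorProjection] at hcomm' ⊢
    simp only [hu1]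
    obtain ⟨w, hw⟩ := R.complex_thd b.2.2
    obtain ⟨j, hj⟩ := R.complex_thd 1
    have hsc : ∀ m : Matrix (Fin 3) (Fin 3) ℂ,
        (∀ n : Matrix (Fin 3) (Fin 3) ℂ,
          R.π (0, 0, m) * R.π (0, 0, n) = R.π (0, 0, n) * R.π (0, 0, m)) →
        ∃ z : ℂ, m = z • (1 : Matrix (Fin 3) (Fin 3) ℂ) := by
      intro m hm
      apply matrix_scalar_of_comm
      intro n
      have h1 := hm n
      rw [← map_mul, ← map_mul] at h1
      simpa using R.faithful h1
    obtain ⟨t, rfl⟩ := hsc j (by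
      intro n
      rw [← hj, smul_mul_assoc, mul_smul_comm, ← map_mul, ← map_mul]
      simp)
    have hjj : t * t = -1 := by
      have h1 : R.π (0, 0, (t * t) • 1) = R.π (0, 0, (-1 : ℂ) • 1) := by
        have h2 : R.π (0, 0, (t * t) • 1) = R.π (0, 0, t • 1) * R.π (0, 0, t • 1) := by
          rw [← map_mul]; simp [smul_smul]
        have h3 : ((0, 0, (-1 : ℂ) • 1) : FoundationalAlgebra) = -(0, 0, 1) := by simp
        have h4 : R.π (0, 0, 1) * R.π (0, 0, 1) = R.π (0, 0, 1) := by
          rw [← map_mul]; simp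
        rw [h2, ← hj, h3, map_neg, smul_mul_smul_comm, h4, hI, neg_one_smul]
      have h5 := congrArg (fun d : FoundationalAlgebra => d.2.2 0 0) (R.faithful h1)
      simpa using h5
    have hsum : ((0, 0, a.2.2) + (0, 0, w) : FoundationalAlgebra) = (0, 0, a.2.2 + w) := by simp
    rw [hw, ← map_add, hsum] at hcomm' ⊢
    obtain ⟨z, hz⟩ := hsc _ fun n => hcomm' (0, 0, n)
    obtain ⟨x, y, hxy⟩ := complex_scalar_of_sq (z := z) hjj
    refine ⟨x + y * Complex.I, ?_⟩
    have h5 : ((0, 0, z • 1) : FoundationalAlgebra) =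
        x • ((0, 0, 1) : FoundationalAlgebra) + y • ((0, 0, t • 1) : FoundationalAlgebra) := by
      simp only [Prod.ext_iff, Prod.smul_mk, Prod.mk_add_mk, smul_zero, add_zero, true_and]
      rw [hxy, add_smul, mul_smul]
      simp only [Complex.coe_smul]
    rw [hz, h5, map_add, R.map_real_smul, R.map_real_smul, ← hj, smul_smul, add_smul]

/-- The sector projections are a labelling of the minimal central projections; in particular there
are exactly three of these. -/
theorem ATRepresentation.isSectorLabelling_sectorProjection (R : ATRepresentation H) :
    R.IsSectorLabelling R.sectorProjection := by
  have key : ∀ (α : Fin 3) (Q : Projection H), Q.1 ∈ R.boundaryAlgebra →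
      (R.sectorProjection α).1 * Q.1 = 0 ∨
        (R.sectorProjection α).1 * Q.1 = (R.sectorProjection α).1 := by
    intro α Q hQ
    obtain ⟨c, hc⟩ := R.boundary_scalar α hQ
    have h1 : (c * c) • (R.sectorProjection α).1 = c • (R.sectorProjection α).1 := by
      calc (c * c) • (R.sectorProjection α).1
          = c • ((R.sectorProjection α).1 * Q.1) := by rw [hc, smul_smul]
        _ = ((R.sectorProjection α).1 * Q.1) * Q.1 := by rw [hc, smul_mul_assoc, hc]
        _ = (R.sectorProjection α).1 * Q.1 := by rw [mul_assoc, Q.2.1.eq]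
        _ = _ := hc
    have h2 : c * c = c := smul_left_injective ℂ (R.sectorProjection_ne_zero α) h1
    rcases IsIdempotentElem.iff_eq_zero_or_one.1 h2 with h | h
    · left; rw [hc, h, zero_smul]
    · right; rw [hc, h, one_smul]
  have hcomm : ∀ (α : Fin 3) (Q : Projection H), Q.1 ∈ R.boundaryAlgebra →
      (R.sectorProjection α).1 * Q.1 = Q.1 * (R.sectorProjection α).1 :=
    fun α Q hQ => (R.sectorProjection_mem α).2 _ hQ.1
  have hmin : ∀ α, R.IsMinimalCentral (R.sectorProjection α) := by
    intro α
    refine ⟨R.sectorProjection_mem α, R.sectorProjection_ne_zero α, fun Q hQ h0 hle => ?_⟩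
    rcases key α Q hQ with h | h
    · exact absurd (hle.symm.trans h) h0
    · exact Subtype.ext (hle.symm.trans h)
  refine ⟨?_, fun Q => ⟨fun hQ => ?_, ?_⟩⟩
  · intro α β h
    have h2 : summandUnit α = summandUnit β := R.faithful (congrArg Subtype.val h)
    revert h2
    fin_cases α <;> fin_cases β <;> simp [summandUnit, Prod.ext_iff]
  · by_contra hne
    push Not at hne
    have h0 : ∀ α, (R.sectorProjection α).1 * Q.1 = 0 := by
      intro α
      rcases key α Q hQ.1 with h | h
      · exact h
      · exact absurd (hQ.2.2 _ (R.sectorProjection_mem α) (R.sectorProjection_ne_zero α)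
          ((hcomm α Q hQ.1).symm.trans h)).symm (hne α)
    apply hQ.2.1
    have hs : ∑ α, (R.sectorProjection α).1 = 1 := by
      simp only [sectorProjection]
      rw [← map_sum, sum_summandUnit, map_one]
    rw [← one_mul Q.1, ← hs, Finset.sum_mul, Finset.sum_eq_zero fun α _ => h0 α]
  · rintro ⟨α, rfl⟩
    exact hmin α

/-- A coherent valuation of the gambles on the three primitive outcomes. -/
structure IsCoherentValuation (V : (Fin 3 → ℝ) → ℝ) : Prop where
  linear : ∀ (a b : ℝ) (f g : Fin 3 → ℝ), V (a • f + b • g) = a * V f + b * V g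
  positive : ∀ f : Fin 3 → ℝ, (∀ α, 0 ≤ f α) → 0 ≤ V f
  normalized : V (fun _ => 1) = 1

/-- A probability assignment on the projection lattice: a normalized, finitely additive,
noncontextual (the value depends on the projection alone) map to `[0, 1]` that extends the
assignment `∑_{α ∈ S} P_α ↦ ∑_{α ∈ S} V(e_α)` induced on the record algebra by some coherent
valuation `V` of gambles. -/
structure ProbabilityAssignment (P : Fin 3 → Projection H) where
  /-- the probability of a projection -/
  prob : Projection H → ℝ
  mem_unitInterval : ∀ Q, 0 ≤ prob Q ∧ prob Q ≤ 1
  normalized : prob ⟨1, IsStarProjection.one _⟩ = 1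
  additive : ∀ (n : ℕ) (Q : Fin n → Projection H),
    (∀ i j, i ≠ j → (Q i).1 * (Q j).1 = 0) → ∑ k, (Q k).1 = 1 →
      prob ⟨1, IsStarProjection.one _⟩ = ∑ k, prob (Q k)
  extends_valuation : ∃ V : (Fin 3 → ℝ) → ℝ, IsCoherentValuation V ∧
    ∀ (S : Finset (Fin 3)) (E : Projection H), E.1 = ∑ α ∈ S, (P α).1 →
      prob E = ∑ α ∈ S, V (Pi.single α 1)

/-- A density operator: positive of trace one. -/
def IsDensityOperator (ρ : H →ₗ[ℂ] H) : Prop :=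
  ρ.IsPositive ∧ LinearMap.trace ℂ H ρ = 1

/-- `ρ` is a density operator and represents the assignment `p` by `p(Q) = Tr(ρ Q)`. -/
def Represents {P : Fin 3 → Projection H} (ρ : H →ₗ[ℂ] H) (p : ProbabilityAssignment P) : Prop :=
  IsDensityOperator ρ ∧ ∀ Q : Projection H, (p.prob Q : ℂ) = LinearMap.trace ℂ H (ρ * Q.1)

/-- `p'` is the epistemic state after the ontological state evolved by `ψ ↦ U ψ`, when it was `p`
before: whenever the event `R` before the evolution and the event `Q` after it are the same
ontological event (`ψ` lies in the subspace of `R` exactly when `U ψ` lies in that of `Q`), the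
probability of `Q` under `p'` is that of `R` under `p`. -/
def IsEvolved {P : Fin 3 → Projection H} (U : unitary (H →ₗ[ℂ] H))
    (p p' : ProbabilityAssignment P) : Prop :=
  ∀ R Q : Projection H,
    (∀ ψ : H, R.1 ψ = ψ ↔ Q.1 ((U : H →ₗ[ℂ] H) ψ) = (U : H →ₗ[ℂ] H) ψ) →
      p'.prob Q = p.prob R

/-- `p'` is a Bayesian posterior of `p` given the recorded boundary event `α`: the event is certain,
and the probabilities of its sub-events `Q ≤ P_α` are the conditional ones. -/
def IsPosterior {P : Fin 3 → Projection H} (α : Fin 3) (p p' : ProbabilityAssignment P) : Prop :=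
  p'.prob (P α) = 1 ∧
    ∀ Q : Projection H, (P α).1 * Q.1 = Q.1 → p'.prob Q = p.prob Q / p.prob (P α)

/-- The dynamical part of an inferential framework: an evolution rule between interactions and an
update rule on recording a boundary event of positive probability. The epistemic states are the
probability assignments; no further law is imposed here. -/
structure InferentialFramework (P : Fin 3 → Projection H) where
  /-- the evolution between interactions -/
  evolve : unitary (H →ₗ[ℂ] H) → ProbabilityAssignment P → ProbabilityAssignment P
  /-- the update on recording the boundary event `α` -/
  condition : (α : Fin 3) → (p : ProbabilityAssignment P) → 0 < p.prob (P α) →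
    ProbabilityAssignment P

/-- The framework is compatible with unitary ontological evolution and with Bayesian conditioning
on boundary events. -/
def InferentialFramework.IsCompatible {P : Fin 3 → Projection H} (F : InferentialFramework P) :
    Prop :=
  (∀ U p, IsEvolved U p (F.evolve U p)) ∧ ∀ α p hp, IsPosterior α p (F.condition α p hp)

end Aperture

/-! ### Polar frame functions on `ℝ³` and descent along great circles -/

section

open scoped RealInnerProductSpace

/-! The heart of the theorem is Gleason's theorem, proved here from scratch. The values of an
epistemic state on lines form a bounded function on rays whose sum over an orthonormal triple
depends only on the span. In dimension at least three such a function is `⟪ρ x, x⟫` on unit vectors,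
for a positive operator `ρ`.

In `ℝ³` the first case is a frame function that vanishes on the equator and is maximal at the pole.
Moving along the great circle whose northernmost point is the current one cannot raise the value. In
the plane of height one such a move multiplies the horizontal part by `1 + it`, and finitely many
moves reach every strictly lower latitude (`exists_spiral`). So the value depends monotonically on
the latitude; by `exists_add` it is additive in the squared height, hence proportional to it
(`eq_mul_sq`). For a general frame function `f`, the sum of `f` and its quarter turn about a maximum
is of this kind up to a constant. Versions of the estimates with an error `ε` show that the maximum
is attained (`exists_max`). Subtracting a quadratic form adapted to a maximum and an orthogonal
minimum leaves a function that is odd under two quarter turns, and such a function is zero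
(`eq_zero_of_antisymm`).

Real planes inside a complex plane then give a Hermitian form on every complex plane, and
polarization assembles these into `ρ` (`exists_operator`).

The dynamics follows. A projection is determined by its fixed vectors, so evolution must be `p^U(Q)
= p(U†QU)`, which is conjugation of `ρ`. A posterior is certain of `P α`, so its positive operator
vanishes on the kernel of `P α` and is determined by its values below `P α`, which conditioning
prescribes. Conversely both formulas yield density operators, and these are epistemic states because
the three `P α` sum to `1`. -/

/-- A real function on the rays of `ℝ³` whose values over every orthogonal frame sum to `w`. -/
structure IsFrameFunction (f : EuclideanSpace ℝ (Fin 3) → ℝ) (w : ℝ) : Prop where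
  smul : ∀ t : ℝ, t ≠ 0 → ∀ x, f (t • x) = f x
  sum_eq : ∀ a b c, a ≠ 0 → b ≠ 0 → c ≠ 0 → ⟪a, b⟫ = 0 → ⟪a, c⟫ = 0 → ⟪b, c⟫ = 0 →
    f a + f b + f c = w

/-- The point of `ℝ³` with horizontal part `ζ` and height `z`. -/
noncomputable def cylPoint (ζ : ℂ) (z : ℝ) : EuclideanSpace ℝ (Fin 3) := !₂[ζ.re, ζ.im, z]

theorem inner_cylPoint (ζ η : ℂ) (z w : ℝ) :
    ⟪cylPoint ζ z, cylPoint η w⟫ = ζ.re * η.re + ζ.im * η.im + z * w := by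
  simp [cylPoint, PiLp.inner_apply, Fin.sum_univ_three]
  ring

theorem smul_cylPoint (t : ℝ) (ζ : ℂ) (z : ℝ) :
    t • cylPoint ζ z = cylPoint (t * ζ) (t * z) := by
  ext i
  fin_cases i <;> simp [cylPoint]

theorem cylPoint_ne_zero_left {ζ : ℂ} (h : ζ ≠ 0) (z : ℝ) : cylPoint ζ z ≠ 0 := by
  intro h0
  apply h
  have h1 := congrArg (fun v : EuclideanSpace ℝ (Fin 3) => v 0) h0
  have h2 := congrArg (fun v : EuclideanSpace ℝ (Fin 3) => v 1) h0
  exact Complex.ext (by simpa [cylPoint] using h1) (by simpa [cylPoint] using h2)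

theorem cylPoint_ne_zero_right (ζ : ℂ) {z : ℝ} (h : z ≠ 0) : cylPoint ζ z ≠ 0 := by
  intro h0
  apply h
  have h1 := congrArg (fun v : EuclideanSpace ℝ (Fin 3) => v 2) h0
  simpa [cylPoint] using h1

theorem cylPoint_ne_zero_of_unit {ζ : ℂ} {z : ℝ} (h : Complex.normSq ζ + z ^ 2 = 1) :
    cylPoint ζ z ≠ 0 := by
  by_cases hζ : ζ = 0
  · apply cylPoint_ne_zero_right
    rintro rfl
    simp [hζ] at h
  · exact cylPoint_ne_zero_left hζ _

theorem exists_eq_cylPoint (x : EuclideanSpace ℝ (Fin 3)) : ∃ ζ z, x = cylPoint ζ z := by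
  refine ⟨⟨x 0, x 1⟩, x 2, ?_⟩
  ext i
  fin_cases i <;> simp [cylPoint]

theorem norm_sq_cylPoint (ζ : ℂ) (z : ℝ) : ‖cylPoint ζ z‖ ^ 2 = Complex.normSq ζ + z ^ 2 := by
  rw [← real_inner_self_eq_norm_sq, inner_cylPoint, Complex.normSq_apply]
  ring

/-- A frame function that vanishes on the equator and nearly attains its upper bound at the pole. -/
structure IsPolarFrameFunction (g : EuclideanSpace ℝ (Fin 3) → ℝ) (k ε : ℝ) : Prop
    extends IsFrameFunction g k where
  equator : ∀ ζ : ℂ, ζ ≠ 0 → g (cylPoint ζ 0) = 0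
  le : ∀ x, x ≠ 0 → g x ≤ k + ε

namespace IsPolarFrameFunction

variable {g : EuclideanSpace ℝ (Fin 3) → ℝ} {k ε : ℝ}

theorem pole (hg : IsPolarFrameFunction g k ε) {z : ℝ} (hz : z ≠ 0) : g (cylPoint 0 z) = k := by
  have h := hg.sum_eq (cylPoint 0 z) (cylPoint 1 0) (cylPoint Complex.I 0)
    (cylPoint_ne_zero_right _ hz) (cylPoint_ne_zero_left one_ne_zero _)
    (cylPoint_ne_zero_left Complex.I_ne_zero _) (by simp [inner_cylPoint])
    (by simp [inner_cylPoint]) (by simp [inner_cylPoint])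
  rw [hg.equator _ one_ne_zero, hg.equator _ Complex.I_ne_zero] at h
  linarith

/-- The two points lie at right angles on one meridian; the axis completing their frame is on the
equator and contributes zero. -/
theorem add_meridian (hg : IsPolarFrameFunction g k ε) {ζ : ℂ} (hζ : ζ ≠ 0) (z : ℝ) :
    g (cylPoint ζ z) + g (cylPoint (-(z * ζ)) (Complex.normSq ζ)) = k := by
  have h := hg.sum_eq (cylPoint ζ z) (cylPoint (-(z * ζ)) (Complex.normSq ζ))
    (cylPoint (Complex.I * ζ) 0)
    (cylPoint_ne_zero_left hζ _) (cylPoint_ne_zero_right _ (Complex.normSq_pos.2 hζ).ne')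
    (cylPoint_ne_zero_left (mul_ne_zero Complex.I_ne_zero hζ) _)
    (by simp [inner_cylPoint, Complex.normSq_apply]; ring)
    (by simp [inner_cylPoint]; ring)
    (by simp [inner_cylPoint]; ring)
  rw [hg.equator _ (mul_ne_zero Complex.I_ne_zero hζ)] at h
  linarith

theorem add_nonneg (hg : IsPolarFrameFunction g k ε) : 0 ≤ k + ε := by
  have := hg.le _ (cylPoint_ne_zero_left one_ne_zero 0)
  rwa [hg.equator _ one_ne_zero] at this

/-- Passing to the orthogonal point of the meridian turns the upper bound `k + ε` into a lower
bound. -/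
theorem neg_le (hg : IsPolarFrameFunction g k ε) {x : EuclideanSpace ℝ (Fin 3)}
    (hx : x ≠ 0) :
    -ε ≤ g x := by
  obtain ⟨ζ, z, rfl⟩ := exists_eq_cylPoint x
  by_cases hζ : ζ = 0
  · subst hζ
    have hz : z ≠ 0 := by
      rintro rfl
      exact hx (by ext i; fin_cases i <;> simp [cylPoint])
    rw [hg.pole hz]
    linarith [hg.add_nonneg]
  · linarith [hg.add_meridian hζ z, hg.le _ (cylPoint_ne_zero_right (-(z * ζ))
      (Complex.normSq_pos.2 hζ).ne')]

/-- Descent along the great circle through a point that has this point as its northernmost one. -/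
theorem descend (hg : IsPolarFrameFunction g k ε) {ζ : ℂ} (hζ : ζ ≠ 0) (t : ℝ) :
    g (cylPoint (ζ * (1 + t * Complex.I)) 1) ≤ g (cylPoint ζ 1) + ε := by
  obtain ⟨r, hr⟩ : ∃ r, r = Complex.normSq ζ := ⟨_, rfl⟩
  have hr0 : 0 < r := hr ▸ Complex.normSq_pos.2 hζ
  have hr' : r = ζ.re * ζ.re + ζ.im * ζ.im := by rw [hr, Complex.normSq_apply]
  have h1 := hg.add_meridian hζ 1
  rw [← hr] at h1
  have hy : cylPoint (ζ * (-(t * r) + (1 + r) * Complex.I)) (-(t * r)) ≠ 0 := by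
    apply cylPoint_ne_zero_left (mul_ne_zero hζ ?_)
    intro h
    have := congrArg Complex.im h
    simp at this
    linarith
  -- The second axis is the normal of the great circle, with value `k - g (cylPoint ζ 1)` by `h1`.
  -- The third lies on the circle, where `g` is at least `-ε`.
  have h2 := hg.sum_eq (cylPoint (ζ * (1 + t * Complex.I)) 1)
    (cylPoint (-((1 : ℝ) * ζ)) r) (cylPoint (ζ * (-(t * r) + (1 + r) * Complex.I)) (-(t * r)))
    (cylPoint_ne_zero_right _ one_ne_zero) (cylPoint_ne_zero_right _ hr0.ne') hy
    (by simp [inner_cylPoint, hr']; ring)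
    (by simp [inner_cylPoint, hr']; ring)
    (by simp [inner_cylPoint, hr']; ring)
  linarith [hg.neg_le hy]

theorem descend_pow (hg : IsPolarFrameFunction g k ε) {ζ : ℂ} (hζ : ζ ≠ 0) (t : ℝ)
    (n : ℕ) : g (cylPoint (ζ * (1 + t * Complex.I) ^ n) 1) ≤ g (cylPoint ζ 1) + n * ε := by
  induction n with
  | zero => simp
  | succ n ih =>
    have h0 : (1 + t * Complex.I : ℂ) ≠ 0 := by
      intro h
      have := congrArg Complex.re h
      simp at this
    have := hg.descend (mul_ne_zero hζ (pow_ne_zero n h0)) t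
    rw [pow_succ, ← mul_assoc]
    push_cast
    linarith

end IsPolarFrameFunction

/-- Turn through `arg w` in `N` equal steps with `t = tan (arg w / N)`. The modulus grows by `cos
(arg w / N) ^ (-N)`, which tends to `1` uniformly in `w` and so drops below `ρ`. The missing radial
factor is at least `1`, hence of the form `1 + s² = (1 + is)(1 - is)`. -/
theorem exists_spiral {ρ : ℝ} (hρ : 1 < ρ) : ∃ N : ℕ, ∀ w : ℂ, ρ ≤ ‖w‖ → ∃ t s : ℝ,
    w = (1 + t * Complex.I) ^ N * (1 + s * Complex.I) * (1 + (-s : ℝ) * Complex.I) := by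
  -- From `π² ≤ 10` and `cos x ≥ 1 - x²/2`, Bernoulli gives `c ^ n ≥ 1 - 5/n`. The second bound on
  -- `n` is what makes `ρ (1 - 5/n) ≥ 1`.
  obtain ⟨n, hn⟩ := exists_nat_gt (max 10 (5 * ρ / (ρ - 1)))
  have hn10 : (10 : ℝ) < n := (le_max_left _ _).trans_lt hn
  have hn5 : 5 * ρ / (ρ - 1) < n := (le_max_right _ _).trans_lt hn
  rw [div_lt_iff₀ (by linarith)] at hn5
  refine ⟨n, fun w hw => ?_⟩
  have hn0 : (n : ℝ) ≠ 0 := by linarith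
  obtain ⟨c, hc⟩ : ∃ c, c = Real.cos (w.arg / n) := ⟨_, rfl⟩
  have hπ : w.arg ^ 2 ≤ 10 := by
    have h1 := Complex.abs_arg_le_pi w
    have h2 := Real.pi_lt_d2
    have h3 := abs_nonneg w.arg
    rw [← sq_abs]
    nlinarith
  have hc1 : 1 - 5 / n ^ 2 ≤ c := by
    have := Real.one_sub_sq_div_two_le_cos (x := w.arg / n)
    rw [← hc] at this
    have h2 : (w.arg / n) ^ 2 / 2 ≤ 5 / n ^ 2 := by
      rw [div_pow, div_div, div_le_div_iff₀ (by positivity) (by positivity)]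
      nlinarith [sq_nonneg (n : ℝ)]
    linarith
  have h5 : 5 / (n : ℝ) ^ 2 ≤ 1 / 2 := by
    rw [div_le_div_iff₀ (by positivity) (by norm_num)]
    nlinarith
  have hc0 : 0 < c := by linarith
  have hcn : 1 - 5 / n ≤ c ^ n := by
    have h1 := one_add_mul_le_pow (a := -(5 / (n : ℝ) ^ 2)) (by linarith) n
    have h2 : (1 + -(5 / (n : ℝ) ^ 2)) ^ n ≤ c ^ n :=
      pow_le_pow_left₀ (by linarith) (by linarith) n
    have h3 : (n : ℝ) * -(5 / (n : ℝ) ^ 2) = -(5 / n) := by field_simp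
    linarith
  have hone : 1 ≤ ‖w‖ * c ^ n := by
    have h1 : 1 ≤ ρ * (1 - 5 / n) := by
      have : ρ * (5 / n) ≤ ρ - 1 := by
        rw [mul_div_assoc', div_le_iff₀ (by linarith)]
        linarith
      linarith
    have h2 : (0 : ℝ) ≤ 1 - 5 / n := by
      have : 5 / (n : ℝ) ≤ 1 := by
        rw [div_le_one (by linarith)]
        linarith
      linarith
    calc 1 ≤ ρ * (1 - 5 / n) := h1
      _ ≤ ‖w‖ * c ^ n := mul_le_mul hw hcn h2 (norm_nonneg _)
  obtain ⟨s, hs⟩ : ∃ s : ℝ, s ^ 2 = ‖w‖ * c ^ n - 1 :=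
    ⟨√(‖w‖ * c ^ n - 1), Real.sq_sqrt (by linarith)⟩
  refine ⟨Real.tan (w.arg / n), s, ?_⟩
  have he : Complex.exp ((w.arg / n : ℝ) * Complex.I) =
      c * (1 + Real.tan (w.arg / n) * Complex.I) := by
    rw [Complex.exp_mul_I, ← Complex.ofReal_cos, ← Complex.ofReal_sin, Real.tan_eq_sin_div_cos, ← hc]
    push_cast
    field_simp [hc0.ne']
  have hw2 : w = ‖w‖ * (c * (1 + Real.tan (w.arg / n) * Complex.I)) ^ n := by
    rw [← he, ← Complex.exp_nat_mul]
    conv_lhs => rw [← Complex.norm_mul_exp_arg_mul_I w]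
    congr 2
    push_cast
    rw [← mul_assoc, mul_div_cancel₀ _ (by exact_mod_cast hn0)]
  have hs2 : (1 + s * Complex.I) * (1 + (-s : ℝ) * Complex.I) = (‖w‖ * c ^ n : ℝ) := by
    have h1 : (1 + s * Complex.I) * (1 + (-s : ℝ) * Complex.I) = ((1 + s ^ 2 : ℝ) : ℂ) := by
      push_cast
      linear_combination -(s : ℂ) ^ 2 * Complex.I_sq
    rw [h1, hs]
    congr 1
    ring
  rw [mul_assoc, hs2]
  conv_lhs => rw [hw2]
  rw [mul_pow]
  push_cast
  ring

end

/-! ### Uniform descent, and smallness near the equator -/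

section

open scoped RealInnerProductSpace

namespace IsPolarFrameFunction

variable {g : EuclideanSpace ℝ (Fin 3) → ℝ} {k ε : ℝ}

theorem nonneg_error (hg : IsPolarFrameFunction g k ε) : 0 ≤ ε := by
  have := hg.le _ (cylPoint_ne_zero_right 0 one_ne_zero)
  rw [hg.pole one_ne_zero] at this
  linarith

/-- For nonzero heights the inequality says `‖η / w‖ ≥ ρ ‖ζ / z‖` after projection to the plane of
height one, so `exists_spiral` supplies the path. The number of steps depends on `ρ` alone, so the
accumulated error is uniform in `g`. -/
theorem descend_far {ρ : ℝ} (hρ : 1 < ρ) : ∃ N : ℕ, ∀ {g : EuclideanSpace ℝ (Fin 3) → ℝ} {k ε : ℝ},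
    IsPolarFrameFunction g k ε → ∀ {ζ η : ℂ} {z w : ℝ},
    Complex.normSq ζ + z ^ 2 = 1 → Complex.normSq η + w ^ 2 = 1 →
    ρ ^ 2 * ((1 - z ^ 2) * w ^ 2) ≤ (1 - w ^ 2) * z ^ 2 →
    g (cylPoint η w) ≤ g (cylPoint ζ z) + N * ε := by
  obtain ⟨N, hN⟩ := exists_spiral hρ
  refine ⟨N + 2, fun {g k ε} hg {ζ η z w} hz hw h => ?_⟩
  have hε := hg.nonneg_error
  have hNε : 0 ≤ N * ε := by positivity
  push_cast
  by_cases hw0 : w = 0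
  · subst hw0
    have hη : η ≠ 0 := by rintro rfl; simp at hw
    have hx := cylPoint_ne_zero_of_unit hz
    rw [hg.equator _ hη]
    linarith [hg.neg_le hx]
  by_cases hζ : ζ = 0
  · subst hζ
    have hz0 : z ≠ 0 := by rintro rfl; simp at hz
    rw [hg.pole hz0]
    linarith [hg.le _ (cylPoint_ne_zero_right η hw0)]
  have hζ0 := Complex.normSq_pos.2 hζ
  have hw2 : 0 < w ^ 2 := by positivity
  have hz0 : z ≠ 0 := by
    rintro rfl
    have : 0 < ρ ^ 2 * ((1 - 0 ^ 2) * w ^ 2) := by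
      have : 0 < ρ := by linarith
      norm_num
      positivity
    linarith
  have hzc : (z : ℂ) ≠ 0 := by exact_mod_cast hz0
  have hwc : (w : ℂ) ≠ 0 := by exact_mod_cast hw0
  obtain ⟨t, s, hts⟩ := hN ((η / w) / (ζ / z)) (by
    apply le_of_sq_le_sq
    · rw [← Complex.normSq_eq_norm_sq, map_div₀, map_div₀, map_div₀, Complex.normSq_ofReal,
        Complex.normSq_ofReal]
      have h1 : Complex.normSq η = 1 - w ^ 2 := by linarith
      have h2 : Complex.normSq ζ = 1 - z ^ 2 := by linarith
      rw [div_div_div_eq, le_div_iff₀ (mul_pos (mul_self_pos.2 hw0) hζ0), h1, h2]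
      nlinarith
    · positivity)
  have hζz : ζ / z ≠ 0 := div_ne_zero hζ hzc
  have hη : η / w = (ζ / z) * (1 + t * Complex.I) ^ N * (1 + s * Complex.I) *
      (1 + (-s : ℝ) * Complex.I) := by
    rw [mul_assoc, mul_assoc, ← mul_assoc (_ ^ N), ← hts, mul_div_cancel₀ _ hζz]
  have hne : ∀ r : ℝ, (1 + r * Complex.I : ℂ) ≠ 0 := by
    intro r h
    have := congrArg Complex.re h
    simp at this
  have h1 := hg.descend_pow hζz t N
  have h2 := hg.descend (mul_ne_zero hζz (pow_ne_zero N (hne t))) s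
  have h3 := hg.descend (mul_ne_zero (mul_ne_zero hζz (pow_ne_zero N (hne t))) (hne s)) (-s)
  rw [← hη] at h3
  have e : ∀ (ξ : ℂ) (v : ℝ), v ≠ 0 → g (cylPoint (ξ / v) 1) = g (cylPoint ξ v) := by
    intro ξ v hv
    have hv' : (v : ℂ) ≠ 0 := by exact_mod_cast hv
    rw [← hg.smul v hv, smul_cylPoint, mul_one, mul_div_cancel₀ _ hv']
  rw [e _ _ hw0] at h3
  rw [e _ _ hz0] at h1
  linarith

/-- Complete the given point and an orthogonal one of squared height `v` to a frame. The third axis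
has squared height `1 - z² - v`, so its orthogonal point on the same meridian has squared height `z²
+ v`. Comparing the frame sum with `add_meridian` gives additivity. -/
theorem exists_add (hg : IsPolarFrameFunction g k ε) {ζ : ℂ} {z v : ℝ}
    (h : Complex.normSq ζ + z ^ 2 = 1) (hv : 0 < v) (hzv : z ^ 2 + v ≤ 1) :
    ∃ (ζ₁ ζ₂ : ℂ) (z₁ z₂ : ℝ), Complex.normSq ζ₁ + z₁ ^ 2 = 1 ∧ Complex.normSq ζ₂ + z₂ ^ 2 = 1 ∧
      z₁ ^ 2 = v ∧ z₂ ^ 2 = z ^ 2 + v ∧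
      g (cylPoint ζ₂ z₂) = g (cylPoint ζ z) + g (cylPoint ζ₁ z₁) := by
  obtain ⟨r, hr⟩ : ∃ r, r = ‖ζ‖ := ⟨_, rfl⟩
  have hr2 : r ^ 2 = 1 - z ^ 2 := by rw [hr, ← Complex.normSq_eq_norm_sq]; linarith
  have hr0 : 0 < r := by
    have : 0 ≤ r := hr ▸ norm_nonneg _
    apply lt_of_le_of_ne this
    rintro rfl
    nlinarith
  obtain ⟨n, hn, hζ⟩ : ∃ n : ℂ, n.re * n.re + n.im * n.im = 1 ∧ ζ = r * n := by
    refine ⟨ζ / r, ?_, ?_⟩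
    · rw [← Complex.normSq_apply, map_div₀, Complex.normSq_ofReal, Complex.normSq_eq_norm_sq, ← hr]
      field_simp
    · rw [mul_div_cancel₀]
      exact_mod_cast hr0.ne'
  -- `C` and `S` are the cosine and sine of an angle in the plane orthogonal to `cylPoint ζ z`,
  -- measured from its highest unit vector, whose height is `r`. The two new axes have heights `C r`
  -- and `-S r`.
  obtain ⟨C, hC⟩ : ∃ C, C ^ 2 * r ^ 2 = v := ⟨√v / r, by
    rw [div_pow, Real.sq_sqrt hv.le, div_mul_cancel₀]; positivity⟩
  obtain ⟨S, hS⟩ : ∃ S, S ^ 2 = 1 - C ^ 2 := ⟨√(1 - C ^ 2), Real.sq_sqrt (by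
    have : r ^ 2 * C ^ 2 ≤ r ^ 2 * 1 := by nlinarith
    have := le_of_mul_le_mul_left this (by positivity)
    linarith)⟩
  have hC0 : C ≠ 0 := by rintro rfl; simp at hC; linarith
  have hn0 : n ≠ 0 := by rintro rfl; simp at hn
  obtain ⟨δ, hδ⟩ : ∃ δ : ℂ, δ = z * S + Complex.I * C := ⟨_, rfl⟩
  have hδ0 : n * δ ≠ 0 := by
    apply mul_ne_zero hn0
    intro h0
    apply hC0
    have := congrArg Complex.im h0
    simpa [hδ] using this
  have hδ2 : Complex.normSq (n * δ) = z ^ 2 * S ^ 2 + C ^ 2 := by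
    rw [map_mul, Complex.normSq_apply, hn, hδ, Complex.normSq_apply]
    simp
    ring
  have hδ3 : z ^ 2 * S ^ 2 + C ^ 2 = z ^ 2 + v := by
    rw [hS, ← hC, hr2]
    ring
  have hzv0 : 0 < z ^ 2 + v := by positivity
  obtain ⟨m, hm⟩ : ∃ m : ℝ, m = √(z ^ 2 + v) := ⟨_, rfl⟩
  have hm0 : 0 < m := hm ▸ Real.sqrt_pos.2 hzv0
  have hm2 : m ^ 2 = z ^ 2 + v := hm ▸ Real.sq_sqrt hzv0.le
  have hd := hg.add_meridian hδ0 (-(S * r))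
  have hf := hg.sum_eq (cylPoint ζ z) (cylPoint (n * (-(z * C) + Complex.I * S)) (C * r))
    (cylPoint (n * δ) (-(S * r)))
    (cylPoint_ne_zero_left (hζ ▸ mul_ne_zero (by exact_mod_cast hr0.ne') hn0) _)
    (cylPoint_ne_zero_right _ (mul_ne_zero hC0 hr0.ne'))
    (cylPoint_ne_zero_left hδ0 _)
    (by simp [inner_cylPoint, hζ]; linear_combination -(r * z * C) * hn)
    (by simp [inner_cylPoint, hζ, hδ]; linear_combination (r * z * S) * hn)
    (by
      simp [inner_cylPoint, hδ]
      linear_combination (S * C * (1 - z ^ 2)) * hn - S * C * hr2)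
  have hcm : cylPoint (-((-(S * r) : ℝ) * (n * δ))) (Complex.normSq (n * δ)) =
      m • cylPoint ((S * r : ℝ) * (n * δ) / m) m := by
    rw [smul_cylPoint, mul_div_cancel₀ _ (by exact_mod_cast hm0.ne'), hδ2, hδ3, ← hm2]
    push_cast
    ring_nf
  rw [hcm, hg.smul _ hm0.ne'] at hd
  refine ⟨n * (-(z * C) + Complex.I * S), (S * r : ℝ) * (n * δ) / m, C * r, m, ?_, ?_, ?_, hm2,
    by linarith⟩
  · rw [map_mul, Complex.normSq_apply, hn, Complex.normSq_apply]
    simp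
    linear_combination C ^ 2 * hr2 + hS
  · rw [map_div₀, map_mul, Complex.normSq_ofReal, Complex.normSq_ofReal, hδ2, hδ3, ← hm2]
    field_simp
    nlinarith
  · rw [mul_pow, hC]

/-- Dividing the squared height by four halves the bound on `g`, up to the descent error. After `j`
rounds the crude bound `|K| + 1` has shrunk below `η / 2`, and `ε` is chosen to keep the error below
`η / 2`. -/
theorem exists_small (K : ℝ) {η : ℝ} (hη : 0 < η) : ∃ δ > 0, ∃ ε > 0,
    ∀ {g : EuclideanSpace ℝ (Fin 3) → ℝ} {k : ℝ}, IsPolarFrameFunction g k ε → k ≤ K →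
      ∀ {ζ : ℂ} {z : ℝ}, Complex.normSq ζ + z ^ 2 = 1 → z ^ 2 ≤ δ → g (cylPoint ζ z) ≤ η := by
  obtain ⟨N, hN⟩ := descend_far (ρ := 3 / 2) (by norm_num)
  obtain ⟨j, hj⟩ := pow_unbounded_of_one_lt (2 * (|K| + 1) / η) (by norm_num : (1 : ℝ) < 2)
  obtain ⟨ε, hε⟩ : ∃ ε, ε = min 1 (η / (2 * (N + 1))) := ⟨_, rfl⟩
  have hε0 : 0 < ε := by rw [hε]; positivity
  have hε1 : ε ≤ 1 := hε ▸ min_le_left _ _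
  have hεN : N * ε ≤ η / 2 := by
    have h1 : ε ≤ η / (2 * (N + 1)) := hε ▸ min_le_right _ _
    rw [le_div_iff₀ (by positivity)] at h1
    nlinarith
  refine ⟨(1 / 4) ^ j, by positivity, ε, hε0, fun {g k} hg hk {ζ z} h hz => ?_⟩
  have key : ∀ (i : ℕ) (ζ : ℂ) (z : ℝ), Complex.normSq ζ + z ^ 2 = 1 → z ^ 2 ≤ (1 / 4) ^ i →
      g (cylPoint ζ z) ≤ (|K| + 1) / 2 ^ i + N * ε := by
    intro i
    induction i with
    | zero =>
      intro ζ z h _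
      have hx := cylPoint_ne_zero_of_unit h
      have := hg.le _ hx
      have : 0 ≤ N * ε := by positivity
      simp only [pow_zero, div_one]
      linarith [le_abs_self K]
    | succ i ih =>
      intro ζ z h hz
      by_cases hz0 : z = 0
      · subst hz0
        rw [hg.equator _ (by rintro rfl; simp at h)]
        positivity
      have hz2 : 0 < z ^ 2 := by positivity
      have hz4 : 4 * z ^ 2 ≤ (1 / 4) ^ i := by rw [pow_succ (1 / 4 : ℝ)] at hz; linarith
      have hi : ((1 / 4 : ℝ)) ^ i ≤ 1 := pow_le_one₀ (by norm_num) (by norm_num)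
      obtain ⟨ζ₁, ζ₂, z₁, z₂, h1, h2, hz1, hz2', hadd⟩ :=
        -- The point of squared height `3 z²` is far enough above the given one for descent with
        -- ratio `3/2`, and the sum `4 z²` falls under the induction hypothesis. Hence twice the
        -- value is at most `g (cylPoint ζ₂ z₂) + N ε`.
        hg.exists_add h (v := 3 * z ^ 2) (by positivity) (by linarith)
      have hb := hN hg h1 h (by rw [hz1]; nlinarith)
      have hc := ih ζ₂ z₂ h2 (by linarith)
      have e : (|K| + 1) / 2 ^ (i + 1) = (|K| + 1) / 2 ^ i / 2 := by rw [pow_succ]; field_simp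
      rw [e]
      linarith
  have h1 := key j ζ z h hz
  rw [div_lt_iff₀ hη] at hj
  have h2 : (|K| + 1) / 2 ^ j ≤ η / 2 := by
    rw [div_le_div_iff₀ (by positivity) (by norm_num)]
    linarith
  linarith

end IsPolarFrameFunction

end

/-! ### Exact polar frame functions are multiples of the squared height -/

section

open scoped RealInnerProductSpace

namespace IsPolarFrameFunction

variable {g : EuclideanSpace ℝ (Fin 3) → ℝ} {k ε : ℝ}

theorem weaken {ε' : ℝ} (hg : IsPolarFrameFunction g k ε) (h : ε ≤ ε') :
    IsPolarFrameFunction g k ε' :=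
  { hg with le := fun x hx => by linarith [hg.le x hx] }

/-- With `ε = 0` the number of descents costs nothing, so any ratio above `1`, here the exact one,
is good enough. -/
theorem mono_latitude (hg : IsPolarFrameFunction g k 0) {ζ η : ℂ} {z w : ℝ}
    (hz : Complex.normSq ζ + z ^ 2 = 1) (hw : Complex.normSq η + w ^ 2 = 1) (h : w ^ 2 < z ^ 2) :
    g (cylPoint η w) ≤ g (cylPoint ζ z) := by
  by_cases hw0 : w = 0
  · subst hw0
    rw [hg.equator _ (by rintro rfl; simp at hw)]
    simpa using hg.neg_le (cylPoint_ne_zero_of_unit hz)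
  by_cases hζ : ζ = 0
  · subst hζ
    rw [hg.pole (by rintro rfl; simp at hz)]
    simpa using hg.le _ (cylPoint_ne_zero_of_unit hw)
  have hζ0 := Complex.normSq_pos.2 hζ
  have h1 : 0 < (1 - z ^ 2) * w ^ 2 := mul_pos (by linarith) (by positivity)
  obtain ⟨ρ, hρ, hρ2⟩ : ∃ ρ : ℝ, 1 < ρ ∧ ρ ^ 2 * ((1 - z ^ 2) * w ^ 2) = (1 - w ^ 2) * z ^ 2 := by
    have h2 : 1 < (1 - w ^ 2) * z ^ 2 / ((1 - z ^ 2) * w ^ 2) := by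
      rw [lt_div_iff₀ h1]
      nlinarith
    refine ⟨√((1 - w ^ 2) * z ^ 2 / ((1 - z ^ 2) * w ^ 2)), ?_, ?_⟩
    · rw [Real.lt_sqrt (by norm_num)]
      simpa using h2
    · rw [Real.sq_sqrt (by linarith), div_mul_cancel₀ _ h1.ne']
  obtain ⟨N, hN⟩ := descend_far hρ
  simpa using hN hg hz hw hρ2.le

/-- `exists_add` with a tiny `v` lifts the first point strictly above the second while raising the
value by at most `η₀`; then `mono_latitude` applies. Exchanging the points gives equality. -/
theorem eq_of_latitude (hg : IsPolarFrameFunction g k 0) {ζ η : ℂ} {z w : ℝ}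
    (hz : Complex.normSq ζ + z ^ 2 = 1) (hw : Complex.normSq η + w ^ 2 = 1) (h : w ^ 2 = z ^ 2) :
    g (cylPoint η w) ≤ g (cylPoint ζ z) := by
  by_cases hζ : ζ = 0
  · subst hζ
    rw [hg.pole (by rintro rfl; simp at hz)]
    simpa using hg.le _ (cylPoint_ne_zero_of_unit hw)
  have hζ0 := Complex.normSq_pos.2 hζ
  apply le_of_forall_pos_le_add
  intro η₀ hη₀
  obtain ⟨δ, hδ, ε, hε, H⟩ := exists_small k hη₀
  obtain ⟨ζ₁, ζ₂, z₁, z₂, h1, h2, hz1, hz2, hadd⟩ :=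
    hg.exists_add hz (v := min δ (1 - z ^ 2)) (lt_min hδ (by linarith))
      (by linarith [min_le_right δ (1 - z ^ 2)])
  have h3 := H (hg.weaken hε.le) le_rfl h1 (hz1 ▸ min_le_left _ _)
  have h4 := hg.mono_latitude h2 hw (by
    rw [hz2, h]
    linarith [lt_min hδ (show 0 < 1 - z ^ 2 by linarith)])
  linarith

/-- A frame function that vanishes on the equator and is maximal at the pole is a multiple of the
square of the height. -/
theorem eq_mul_sq (hg : IsPolarFrameFunction g k 0) {ζ : ℂ} {z : ℝ}
    (h : Complex.normSq ζ + z ^ 2 = 1) : g (cylPoint ζ z) = k * z ^ 2 := by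
  have hk : 0 ≤ k := by simpa using hg.add_nonneg
  -- Doubling `z²` doubles the deviation from `k z²`, so where doubling is possible the deviation is
  -- at most half the current bound.
  have low : ∀ (j : ℕ), (∀ (ζ : ℂ) (z : ℝ), Complex.normSq ζ + z ^ 2 = 1 →
      |g (cylPoint ζ z) - k * z ^ 2| ≤ k / 2 ^ j) → ∀ (ζ : ℂ) (z : ℝ),
      Complex.normSq ζ + z ^ 2 = 1 → z ^ 2 ≤ 1 / 2 →
      |g (cylPoint ζ z) - k * z ^ 2| ≤ k / 2 ^ (j + 1) := by
    intro j ih ζ z h hz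
    by_cases hz0 : z = 0
    · subst hz0
      rw [hg.equator _ (by rintro rfl; simp at h)]
      simp
      positivity
    obtain ⟨ζ₁, ζ₂, z₁, z₂, h1, h2, hz1, hz2, hadd⟩ :=
      hg.exists_add h (v := z ^ 2) (by positivity) (by linarith)
    have h3 := ih ζ₂ z₂ h2
    have h4 : g (cylPoint ζ₁ z₁) = g (cylPoint ζ z) :=
      le_antisymm (hg.eq_of_latitude h h1 hz1) (hg.eq_of_latitude h1 h hz1.symm)
    have h5 : g (cylPoint ζ₂ z₂) - k * z₂ ^ 2 = 2 * (g (cylPoint ζ z) - k * z ^ 2) := by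
      rw [hadd, h4, hz2]
      ring
    rw [h5, abs_mul, abs_two] at h3
    rw [pow_succ (2 : ℝ), ← div_div]
    linarith
  have key : ∀ (j : ℕ) (ζ : ℂ) (z : ℝ), Complex.normSq ζ + z ^ 2 = 1 →
      |g (cylPoint ζ z) - k * z ^ 2| ≤ k / 2 ^ j := by
    intro j
    induction j with
    | zero =>
      intro ζ z h
      have h1 := hg.le _ (cylPoint_ne_zero_of_unit h)
      have h2 := hg.neg_le (cylPoint_ne_zero_of_unit h)
      have h3 : z ^ 2 ≤ 1 := by linarith [Complex.normSq_nonneg ζ]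
      rw [abs_le]
      simp only [pow_zero, div_one]
      constructor <;> nlinarith [sq_nonneg z]
    | succ j ih =>
      intro ζ z h
      rcases le_or_gt (z ^ 2) (1 / 2) with hz | hz
      · exact low j ih ζ z h hz
      by_cases hζ : ζ = 0
      · subst hζ
        have hz1 : z ^ 2 = 1 := by simpa using h
        rw [hg.pole (by rintro rfl; simp at h), hz1]
        simp
        positivity
      -- For `z² > 1/2` the orthogonal point of the meridian has squared height `1 - z²`, and its
      -- deviation is the opposite one.
      obtain ⟨r, hr⟩ : ∃ r, r = ‖ζ‖ := ⟨_, rfl⟩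
      have hr0 : 0 < r := hr ▸ norm_pos_iff.2 hζ
      have hr2 : Complex.normSq ζ = r ^ 2 := by rw [hr, Complex.normSq_eq_norm_sq]
      have hm := hg.add_meridian hζ z
      have hcm : cylPoint (-(z * ζ)) (Complex.normSq ζ) = r • cylPoint (-(z * ζ) / r) r := by
        rw [smul_cylPoint, mul_div_cancel₀ _ (by exact_mod_cast hr0.ne'), hr2, sq]
      rw [hcm, hg.smul _ hr0.ne'] at hm
      rw [hr2] at h
      have h1 : Complex.normSq (-(z * ζ) / r) + r ^ 2 = 1 := by
        rw [map_div₀, Complex.normSq_neg, map_mul, Complex.normSq_ofReal, Complex.normSq_ofReal,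
          hr2]
        field_simp
        linarith
      have h2 := low j ih _ r h1 (by linarith)
      have h3 : g (cylPoint (-(z * ζ) / r) r) - k * r ^ 2 = -(g (cylPoint ζ z) - k * z ^ 2) := by
        linear_combination hm - k * h
      rwa [h3, abs_neg] at h2
  have hlim : Filter.Tendsto (fun j : ℕ => k / 2 ^ j) Filter.atTop (nhds 0) := by
    have := (tendsto_pow_atTop_nhds_zero_of_lt_one (r := (1 / 2 : ℝ)) (by norm_num)
      (by norm_num)).const_mul k
    simpa [div_eq_mul_inv] using this
  have h0 := ge_of_tendsto' hlim fun j => key j ζ z h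
  have h1 := abs_nonpos_iff.1 h0
  linarith

end IsPolarFrameFunction

end

/-! ### Symmetrization about a point, and attainment of the maximum -/

section

open scoped RealInnerProductSpace

/-- Rotation by a right angle about the vertical axis. -/
noncomputable def quarterTurn (x : EuclideanSpace ℝ (Fin 3)) : EuclideanSpace ℝ (Fin 3) :=
  !₂[-x 1, x 0, x 2]

theorem quarterTurn_cylPoint (ζ : ℂ) (z : ℝ) :
    quarterTurn (cylPoint ζ z) = cylPoint (Complex.I * ζ) z := by
  ext i
  fin_cases i <;> simp [cylPoint, quarterTurn]

theorem quarterTurn_smul (t : ℝ) (x : EuclideanSpace ℝ (Fin 3)) :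
    quarterTurn (t • x) = t • quarterTurn x := by
  ext i
  fin_cases i <;> simp [quarterTurn]

theorem inner_quarterTurn (x y : EuclideanSpace ℝ (Fin 3)) :
    ⟪quarterTurn x, quarterTurn y⟫ = ⟪x, y⟫ := by
  simp [quarterTurn, PiLp.inner_apply, Fin.sum_univ_three]
  ring

theorem quarterTurn_ne_zero {x : EuclideanSpace ℝ (Fin 3)} (hx : x ≠ 0) : quarterTurn x ≠ 0 := by
  rw [← inner_self_ne_zero (𝕜 := ℝ), inner_quarterTurn]
  exact inner_self_ne_zero.2 hx

theorem exists_isometry_pole {p : EuclideanSpace ℝ (Fin 3)} (hp : ‖p‖ = 1) :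
    ∃ J : EuclideanSpace ℝ (Fin 3) ≃ₗᵢ[ℝ] EuclideanSpace ℝ (Fin 3), J (cylPoint 0 1) = p := by
  obtain ⟨b, hb⟩ := Orthonormal.exists_orthonormalBasis_extension_of_card_eq (𝕜 := ℝ)
    (E := EuclideanSpace ℝ (Fin 3)) (ι := Fin 3) (by simp) (v := fun _ => p) (s := {2})
    ⟨fun _ => hp, fun i j hij => absurd (Subsingleton.elim i j) hij⟩
  refine ⟨b.repr.symm, ?_⟩
  have : cylPoint 0 1 = EuclideanSpace.single (2 : Fin 3) (1 : ℝ) := by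
    ext i
    fin_cases i <;> simp [cylPoint]
  rw [this, b.repr_symm_single, hb 2 rfl]

namespace IsFrameFunction

variable {f : EuclideanSpace ℝ (Fin 3) → ℝ} {w : ℝ}

theorem comp (hf : IsFrameFunction f w)
    (J : EuclideanSpace ℝ (Fin 3) ≃ₗᵢ[ℝ] EuclideanSpace ℝ (Fin 3)) :
    IsFrameFunction (fun x => f (J x)) w where
  smul t ht x := by rw [map_smul, hf.smul t ht]
  sum_eq a b c ha hb hc hab hac hbc := hf.sum_eq _ _ _ (by simpa) (by simpa) (by simpa)
    (by simpa) (by simpa) (by simpa)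

theorem neg (hf : IsFrameFunction f w) : IsFrameFunction (fun x => -f x) (-w) where
  smul t ht x := by rw [hf.smul t ht]
  sum_eq a b c ha hb hc hab hac hbc := by linarith [hf.sum_eq a b c ha hb hc hab hac hbc]

theorem normalize (hf : IsFrameFunction f w) {x : EuclideanSpace ℝ (Fin 3)} (hx : x ≠ 0) :
    ∃ y, ‖y‖ = 1 ∧ f y = f x :=
  ⟨‖x‖⁻¹ • x, norm_smul_inv_norm hx, hf.smul _ (inv_ne_zero (norm_ne_zero_iff.2 hx)) _⟩

/-- A point of the equator, its quarter turn and the pole form a frame, so the symmetrized function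
is constant on the equator. The subtracted constant is that value, and the error measures how far
the pole is from maximal. -/
theorem isPolar (hf : IsFrameFunction f w) {M : ℝ} (hM : ∀ x, x ≠ 0 → f x ≤ M) :
    IsPolarFrameFunction (fun x => f x + f (quarterTurn x) - (w - f (cylPoint 0 1)))
      (3 * f (cylPoint 0 1) - w) (2 * (M - f (cylPoint 0 1))) where
  smul t ht x := by rw [quarterTurn_smul, hf.smul t ht, hf.smul t ht]
  sum_eq a b c ha hb hc hab hac hbc := by
    have h1 := hf.sum_eq a b c ha hb hc hab hac hbc
    have h2 := hf.sum_eq _ _ _ (quarterTurn_ne_zero ha) (quarterTurn_ne_zero hb)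
      (quarterTurn_ne_zero hc) ((inner_quarterTurn _ _).trans hab)
      ((inner_quarterTurn _ _).trans hac) ((inner_quarterTurn _ _).trans hbc)
    linarith
  equator ζ hζ := by
    have := hf.sum_eq (cylPoint 0 1) (cylPoint ζ 0) (cylPoint (Complex.I * ζ) 0)
      (cylPoint_ne_zero_right _ one_ne_zero) (cylPoint_ne_zero_left hζ _)
      (cylPoint_ne_zero_left (mul_ne_zero Complex.I_ne_zero hζ) _)
      (by simp [inner_cylPoint]) (by simp [inner_cylPoint]) (by simp [inner_cylPoint]; ring)
    rw [quarterTurn_cylPoint]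
    linarith
  le x hx := by
    linarith [hM x hx, hM _ (quarterTurn_ne_zero hx)]

/-- This replaces continuity. Symmetrize about `p`: the orthogonal point of the meridian through `x`
is near the equator, where `exists_small` applies, so the symmetrized value at `x` is nearly that at
`p`. As the turned point contributes at most `M`, `f x` itself must be close to `M`. -/
theorem exists_near_max (C : ℝ) {η : ℝ} (hη : 0 < η) : ∃ δ > 0, ∃ ε > 0,
    ∀ {f : EuclideanSpace ℝ (Fin 3) → ℝ} {w M : ℝ}, IsFrameFunction f w →
      (∀ x, |f x| ≤ C) → (∀ x, x ≠ 0 → f x ≤ M) → ∀ {p x : EuclideanSpace ℝ (Fin 3)},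
      ‖p‖ = 1 → ‖x‖ = 1 → M - ε ≤ f p → 1 - δ ≤ ⟪p, x⟫ ^ 2 → M - η ≤ f x := by
  obtain ⟨δ, hδ, ε, hε, H⟩ := IsPolarFrameFunction.exists_small (6 * C) (half_pos hη)
  -- The polar error is `2 (M - f p)`, whence `ε / 2`; the final estimate loses `2 (M - f p) + η /
  -- 2`, whence `η / 4`.
  refine ⟨δ, hδ, min (ε / 2) (η / 4), by positivity, fun {f w M} hf hC hM {p x} hp hx hpM hpx => ?_⟩
  have hmin1 := min_le_left (ε / 2) (η / 4)
  have hmin2 := min_le_right (ε / 2) (η / 4)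
  obtain ⟨J, rfl⟩ := exists_isometry_pole hp
  obtain ⟨x, rfl⟩ := J.surjective x
  obtain ⟨ζ, z, rfl⟩ := exists_eq_cylPoint x
  have hfJ := hf.comp J
  have hMJ : ∀ x, x ≠ 0 → f (J x) ≤ M := fun x hx => hM _ (by simpa)
  have hg := (hfJ.isPolar hMJ).weaken (ε' := ε) (by linarith)
  rw [J.norm_map] at hx
  rw [J.inner_map_map, inner_cylPoint] at hpx
  have hz : Complex.normSq ζ + z ^ 2 = 1 := by rw [← norm_sq_cylPoint, hx, one_pow]
  simp only [Complex.zero_re, Complex.zero_im, zero_mul, zero_add, one_mul] at hpx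
  by_cases hζ : ζ = 0
  · subst hζ
    have h1 := hfJ.smul z (by rintro rfl; simp at hz) (cylPoint 0 1)
    rw [smul_cylPoint, mul_zero, mul_one] at h1
    rw [h1]
    linarith
  have hm := hg.add_meridian hζ z
  obtain ⟨r, hr⟩ : ∃ r, r = ‖ζ‖ := ⟨_, rfl⟩
  have hr0 : 0 < r := hr ▸ norm_pos_iff.2 hζ
  have hr2 : Complex.normSq ζ = r ^ 2 := by rw [hr, Complex.normSq_eq_norm_sq]
  have hcm : cylPoint (-(z * ζ)) (Complex.normSq ζ) = r • cylPoint (-(z * ζ) / r) r := by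
    rw [smul_cylPoint, mul_div_cancel₀ _ (by exact_mod_cast hr0.ne'), hr2, sq]
  rw [hcm, hg.smul _ hr0.ne'] at hm
  have h1 : Complex.normSq (-(z * ζ) / r) + r ^ 2 = 1 := by
    rw [map_div₀, Complex.normSq_neg, map_mul, Complex.normSq_ofReal, Complex.normSq_ofReal, hr2]
    field_simp
    linarith
  have hw : 3 * f (J (cylPoint 0 1)) - w ≤ 6 * C := by
    have h2 := hfJ.sum_eq (cylPoint 0 1) (cylPoint 1 0) (cylPoint Complex.I 0)
      (cylPoint_ne_zero_right _ one_ne_zero) (cylPoint_ne_zero_left one_ne_zero _)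
      (cylPoint_ne_zero_left Complex.I_ne_zero _) (by simp [inner_cylPoint])
      (by simp [inner_cylPoint]) (by simp [inner_cylPoint])
    have h3 := abs_le.1 (hC (J (cylPoint 0 1)))
    have h4 := abs_le.1 (hC (J (cylPoint 1 0)))
    have h5 := abs_le.1 (hC (J (cylPoint Complex.I 0)))
    linarith
  have h2 := H hg hw h1 (by linarith)
  have h3 := hMJ _ (quarterTurn_ne_zero (cylPoint_ne_zero_left hζ z))
  linarith

/-- A maximizing sequence on the sphere has a limit point `q`. Terms close to `q` are nearly
maximal, and `exists_near_max` carries this over to `q`. -/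
theorem exists_max (hf : IsFrameFunction f w) {C : ℝ} (hC : ∀ x, |f x| ≤ C) :
    ∃ p, ‖p‖ = 1 ∧ ∀ x, x ≠ 0 → f x ≤ f p := by
  obtain ⟨S, hS⟩ : ∃ S, S = f '' Metric.sphere 0 1 := ⟨_, rfl⟩
  have hbdd : BddAbove S := ⟨C, by
    rw [hS]
    rintro _ ⟨x, _, rfl⟩
    exact (abs_le.1 (hC x)).2⟩
  have hne : S.Nonempty := by
    rw [hS]
    exact (NormedSpace.sphere_nonempty.2 zero_le_one).image f
  obtain ⟨M, hM⟩ : ∃ M, M = sSup S := ⟨_, rfl⟩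
  have hle : ∀ x, x ≠ 0 → f x ≤ M := by
    intro x hx
    obtain ⟨y, hy, hyx⟩ := hf.normalize hx
    rw [← hyx, hM]
    exact le_csSup hbdd (by rw [hS]; exact ⟨y, by simpa using hy, rfl⟩)
  have hseq : ∀ n : ℕ, ∃ p : EuclideanSpace ℝ (Fin 3), p ∈ Metric.sphere 0 1 ∧
      M - 1 / ((n : ℝ) + 1) < f p := by
    intro n
    obtain ⟨_, hs, hlt⟩ := exists_lt_of_lt_csSup hne
      (show M - 1 / ((n : ℝ) + 1) < sSup S by
        rw [← hM]
        have : 0 < 1 / ((n : ℝ) + 1) := by positivity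
        linarith)
    rw [hS] at hs
    obtain ⟨p, hp, rfl⟩ := hs
    exact ⟨p, hp, hlt⟩
  choose p hp hpM using hseq
  obtain ⟨q, hq, φ, hφ, hlim⟩ := (isCompact_sphere (0 : EuclideanSpace ℝ (Fin 3)) 1).tendsto_subseq hp
  have hq1 : ‖q‖ = 1 := by simpa using hq
  refine ⟨q, hq1, fun x hx => (hle x hx).trans ?_⟩
  apply le_of_forall_pos_le_add
  intro η hη
  obtain ⟨δ, hδ, ε, hε, H⟩ := exists_near_max C hη
  have hinner : Filter.Tendsto (fun n => ⟪p (φ n), q⟫ ^ 2) Filter.atTop (nhds 1) := by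
    have h1 := (Filter.Tendsto.inner (𝕜 := ℝ) hlim (tendsto_const_nhds (x := q))).pow 2
    simpa [real_inner_self_eq_norm_sq, hq1] using h1
  have hval : Filter.Tendsto (fun n => 1 / (((φ n : ℕ) : ℝ) + 1)) Filter.atTop (nhds 0) :=
    tendsto_one_div_add_atTop_nhds_zero_nat.comp hφ.tendsto_atTop
  obtain ⟨n, hn1, hn2⟩ := ((hinner.eventually_const_le (show 1 - δ < 1 by linarith)).and
    (hval.eventually_le_const hε)).exists
  have := H hf hC hle (by simpa using hp (φ n)) hq1 (by linarith [hpM (φ n)]) hn1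
  linarith

/-- The two inner products express that `y` is `x` turned by a right angle about `p`, in either
sense. Symmetrization about a true maximum has error zero, so `eq_mul_sq` evaluates it. -/
theorem add_quarterTurn (hf : IsFrameFunction f w) {p : EuclideanSpace ℝ (Fin 3)} (hp : ‖p‖ = 1)
    (hmax : ∀ x, x ≠ 0 → f x ≤ f p) {x y : EuclideanSpace ℝ (Fin 3)} (hx : ‖x‖ = 1) (hy : ‖y‖ = 1)
    (hxy : ⟪p, y⟫ = ⟪p, x⟫) (hxy' : ⟪x, y⟫ = ⟪p, x⟫ ^ 2) :
    f x + f y = (w - f p) + (3 * f p - w) * ⟪p, x⟫ ^ 2 := by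
  obtain ⟨J, rfl⟩ := exists_isometry_pole hp
  obtain ⟨x, rfl⟩ := J.surjective x
  obtain ⟨y, rfl⟩ := J.surjective y
  obtain ⟨ζ, z, rfl⟩ := exists_eq_cylPoint x
  obtain ⟨η, v, rfl⟩ := exists_eq_cylPoint y
  have hfJ := hf.comp J
  have hMJ : ∀ x, x ≠ 0 → f (J x) ≤ f (J (cylPoint 0 1)) := fun x hx => hmax _ (by simpa)
  have hg := (hfJ.isPolar hMJ).weaken (ε' := 0) (by linarith)
  rw [J.norm_map] at hx hy
  rw [J.inner_map_map, J.inner_map_map, inner_cylPoint, inner_cylPoint] at *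
  simp only [Complex.zero_re, Complex.zero_im, zero_mul, zero_add, one_mul] at *
  subst hxy
  have h1 : Complex.normSq ζ + v ^ 2 = 1 := by rw [← norm_sq_cylPoint, hx, one_pow]
  have h2 : Complex.normSq η + v ^ 2 = 1 := by rw [← norm_sq_cylPoint, hy, one_pow]
  have h3 := hg.eq_mul_sq h1
  have h4 := hg.eq_mul_sq h2
  simp only [quarterTurn_cylPoint] at h3 h4
  rw [Complex.normSq_apply] at h1 h2
  -- The horizontal parts are orthogonal of equal length, so their determinant is plus or minus that
  -- length squared: one sign for each sense of rotation.
  have h5 : (ζ.re * η.im - ζ.im * η.re - (1 - v ^ 2)) *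
      (ζ.re * η.im - ζ.im * η.re + (1 - v ^ 2)) = 0 := by
    have h6 : ζ.re * η.re + ζ.im * η.im = 0 := by linarith
    linear_combination (η.re * η.re + η.im * η.im) * h1 + (1 - v ^ 2) * h2 -
      (ζ.re * η.re + ζ.im * η.im) * h6
  rcases mul_eq_zero.1 h5 with h | h
  · have h6 : (η.re + ζ.im) ^ 2 + (η.im - ζ.re) ^ 2 = 0 := by
      linear_combination h1 + h2 - 2 * h
    have h7 : η = Complex.I * ζ := by
      have h8 : η.re + ζ.im = 0 := pow_eq_zero_iff two_ne_zero |>.1 (by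
        linarith [sq_nonneg (η.re + ζ.im), sq_nonneg (η.im - ζ.re)])
      have h9 : η.im - ζ.re = 0 := pow_eq_zero_iff two_ne_zero |>.1 (by
        linarith [sq_nonneg (η.re + ζ.im), sq_nonneg (η.im - ζ.re)])
      apply Complex.ext <;> simp <;> linarith
    rw [← h7] at h3
    linarith
  · have h6 : (η.re - ζ.im) ^ 2 + (η.im + ζ.re) ^ 2 = 0 := by
      linear_combination h1 + h2 + 2 * h
    have h7 : ζ = Complex.I * η := by
      have h8 : η.re - ζ.im = 0 := pow_eq_zero_iff two_ne_zero |>.1 (by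
        linarith [sq_nonneg (η.re - ζ.im), sq_nonneg (η.im + ζ.re)])
      have h9 : η.im + ζ.re = 0 := pow_eq_zero_iff two_ne_zero |>.1 (by
        linarith [sq_nonneg (η.re - ζ.im), sq_nonneg (η.im + ζ.re)])
      apply Complex.ext <;> simp <;> linarith
    rw [← h7] at h4
    linarith

theorem exists_quarterTurn {p x : EuclideanSpace ℝ (Fin 3)} (hp : ‖p‖ = 1) (hx : ‖x‖ = 1) :
    ∃ y, ‖y‖ = 1 ∧ ⟪p, y⟫ = ⟪p, x⟫ ∧ ⟪x, y⟫ = ⟪p, x⟫ ^ 2 := by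
  obtain ⟨J, rfl⟩ := exists_isometry_pole hp
  obtain ⟨x, rfl⟩ := J.surjective x
  obtain ⟨ζ, z, rfl⟩ := exists_eq_cylPoint x
  refine ⟨J (quarterTurn (cylPoint ζ z)), ?_, ?_, ?_⟩
  · rw [J.norm_map] at hx ⊢
    rw [← sq_eq_sq₀ (norm_nonneg _) zero_le_one, ← real_inner_self_eq_norm_sq, inner_quarterTurn,
      real_inner_self_eq_norm_sq, hx]
  · rw [J.inner_map_map, J.inner_map_map, quarterTurn_cylPoint, inner_cylPoint, inner_cylPoint]
    simp
  · rw [J.inner_map_map, J.inner_map_map, quarterTurn_cylPoint, inner_cylPoint, inner_cylPoint]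
    simp
    ring

end IsFrameFunction

end

/-! ### Gleason's theorem in `ℝ³` -/

section

open scoped RealInnerProductSpace

/-- Parseval's identity for the `j`-th unit vector; it makes diagonal quadratic forms into frame
functions. -/
theorem sum_sq_coord_div_eq_one {a b c : EuclideanSpace ℝ (Fin 3)} (ha : a ≠ 0) (hb : b ≠ 0)
    (hc : c ≠ 0) (hab : ⟪a, b⟫ = 0) (hac : ⟪a, c⟫ = 0) (hbc : ⟪b, c⟫ = 0) (j : Fin 3) :
    a j ^ 2 / ‖a‖ ^ 2 + b j ^ 2 / ‖b‖ ^ 2 + c j ^ 2 / ‖c‖ ^ 2 = 1 := by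
  obtain ⟨v, hv⟩ : ∃ v : Fin 3 → EuclideanSpace ℝ (Fin 3),
    v = ![‖a‖⁻¹ • a, ‖b‖⁻¹ • b, ‖c‖⁻¹ • c] := ⟨_, rfl⟩
  have hon : Orthonormal ℝ v := by
    constructor
    · intro i
      fin_cases i
      · simpa [hv] using norm_smul_inv_norm (𝕜 := ℝ) ha
      · simpa [hv] using norm_smul_inv_norm (𝕜 := ℝ) hb
      · simpa [hv] using norm_smul_inv_norm (𝕜 := ℝ) hc
    · intro i k hik
      fin_cases i <;> fin_cases k <;>
        simp_all [inner_smul_left, inner_smul_right, real_inner_comm]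
  obtain ⟨B, hB⟩ := Orthonormal.exists_orthonormalBasis_extension_of_card_eq (𝕜 := ℝ)
    (ι := Fin 3) (by simp) (v := v) (s := Set.univ) (hon.comp _ Subtype.val_injective)
  have h := B.sum_sq_norm_inner_right (EuclideanSpace.single j (1 : ℝ))
  simp only [Fin.sum_univ_three, hB _ (Set.mem_univ _), hv] at h
  simp [inner_smul_left, EuclideanSpace.inner_single_right, mul_pow] at h
  rw [← h]
  field_simp

theorem abs_add_le_half_or {u v : ℝ} (hu : |u| ≤ 1 / 2) (hv : |v| ≤ 1 / 2) :
    |u + v| ≤ 1 / 2 ∨ |u - v| ≤ 1 / 2 := by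
  rw [abs_le] at *
  rw [abs_le]
  rcases le_total 0 u with h1 | h1 <;> rcases le_total 0 v with h2 | h2
  · exact Or.inr (by constructor <;> linarith)
  · exact Or.inl (by constructor <;> linarith)
  · exact Or.inl (by constructor <;> linarith)
  · exact Or.inr (by constructor <;> linarith)

namespace IsFrameFunction

variable {f : EuclideanSpace ℝ (Fin 3) → ℝ} {w : ℝ}

/-- A bounded frame function of weight zero that changes sign under the quarter turns about the
first and the third axis vanishes. -/
theorem eq_zero_of_antisymm (hf : IsFrameFunction f 0) {C : ℝ} (hC : ∀ x, |f x| ≤ C)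
    (h0 : ∀ a b c : ℝ, a ^ 2 + b ^ 2 + c ^ 2 = 1 →
      f (cylPoint ⟨a, b⟩ c) = -f (cylPoint ⟨a, -c⟩ b))
    (h2 : ∀ a b c : ℝ, a ^ 2 + b ^ 2 + c ^ 2 = 1 →
      f (cylPoint ⟨a, b⟩ c) = -f (cylPoint ⟨-b, a⟩ c)) {a b c : ℝ}
    (h : a ^ 2 + b ^ 2 + c ^ 2 = 1) : f (cylPoint ⟨a, b⟩ c) = 0 := by
  have hneg : ∀ a b c : ℝ, f (cylPoint ⟨-a, -b⟩ (-c)) = f (cylPoint ⟨a, b⟩ c) := by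
    intro a b c
    rw [← hf.smul (-1) (by norm_num) (cylPoint ⟨a, b⟩ c), smul_cylPoint]
    congr 2
    · apply Complex.ext <;> simp
    · ring
  have hcyc : ∀ a b c : ℝ, a ^ 2 + b ^ 2 + c ^ 2 = 1 →
      f (cylPoint ⟨b, c⟩ a) = f (cylPoint ⟨a, b⟩ c) := by
    intro a b c h
    rw [h0 b c a (by linarith), h2 b (-a) c (by linarith)]
    simp
  have hsign : ∀ a b c : ℝ, a ^ 2 + b ^ 2 + c ^ 2 = 1 →
      f (cylPoint ⟨-a, b⟩ c) = f (cylPoint ⟨a, b⟩ c) := by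
    intro a b c h
    rw [h0 a b c h, h0 a (-c) b (by linarith), neg_neg, ← hneg a]
    simp
  have hsign2 : ∀ a b c : ℝ, a ^ 2 + b ^ 2 + c ^ 2 = 1 →
      f (cylPoint ⟨a, -b⟩ c) = f (cylPoint ⟨a, b⟩ c) := by
    intro a b c h
    rw [← hcyc a (-b) c (by linarith), hsign b c a (by linarith), hcyc a b c h]
  have hsign3 : ∀ a b c : ℝ, a ^ 2 + b ^ 2 + c ^ 2 = 1 →
      f (cylPoint ⟨a, b⟩ (-c)) = f (cylPoint ⟨a, b⟩ c) := by
    intro a b c h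
    rw [← hcyc a b (-c) (by linarith), hsign2 b c a (by linarith), hcyc a b c h]
  have hunit : ∀ a b c : ℝ, a ^ 2 + b ^ 2 + c ^ 2 = 1 ↔ ‖cylPoint ⟨a, b⟩ c‖ = 1 := by
    intro a b c
    rw [← sq_eq_sq₀ (norm_nonneg _) zero_le_one, norm_sq_cylPoint, Complex.normSq_apply]
    constructor <;> intro h <;> linarith
  have hpos : ∀ a b c : ℝ, a ^ 2 + b ^ 2 + c ^ 2 = 1 → cylPoint ⟨a, b⟩ c ≠ 0 := by
    intro a b c h h0
    have := (hunit a b c).1 h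
    rw [h0, norm_zero] at this
    exact zero_ne_one this
  obtain ⟨s, hs, hmax⟩ := hf.exists_max hC
  obtain ⟨⟨x, y⟩, z, rfl⟩ := exists_eq_cylPoint s
  have hs' := (hunit _ _ _).2 hs
  -- By the symmetries, a suitably signed cyclic shift `s'` of the maximum point `s` has the same
  -- value `M`, and signs can be chosen so that `|⟪s, s'⟫| ≤ 1/2`. If `t` is `s'` turned about `s`,
  -- then `M + f t = -M + 3 M ⟪s, s'⟫² ≤ -M/4` when `M ≥ 0`. But `f t ≥ -M` by antisymmetry, so `M ≤
  -- 0`.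
  have hM : f (cylPoint ⟨x, y⟩ z) ≤ 0 := by
    have e : ∀ u v : ℝ, u ^ 2 + v ^ 2 ≤ 1 → |u * v| ≤ 1 / 2 := by
      intro u v h
      rw [abs_le]
      constructor <;> nlinarith [sq_nonneg (u + v), sq_nonneg (u - v)]
    have e1 := e x y (by nlinarith)
    have e2 := e y z (by nlinarith)
    have e3 := e z x (by nlinarith)
    obtain ⟨y', z', x', hx', hfx', hin⟩ : ∃ y' z' x' : ℝ, y' ^ 2 + z' ^ 2 + x' ^ 2 = 1 ∧
        f (cylPoint ⟨y', z'⟩ x') = f (cylPoint ⟨x, y⟩ z) ∧ |x * y' + y * z' + z * x'| ≤ 1 / 2 := by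
      have hu : y ^ 2 + z ^ 2 + x ^ 2 = 1 := by linarith
      rcases abs_add_le_half_or e1 e2 with h1 | h1 <;>
        rcases abs_add_le_half_or h1 e3 with h4 | h4
      · exact ⟨y, z, x, hu, hcyc _ _ _ hs', h4⟩
      · refine ⟨y, z, -x, by linarith, (hsign3 _ _ _ hu).trans (hcyc _ _ _ hs'), ?_⟩
        rwa [mul_neg, ← sub_eq_add_neg]
      · refine ⟨y, -z, x, by linarith, (hsign2 _ _ _ hu).trans (hcyc _ _ _ hs'), ?_⟩
        rwa [mul_neg, ← sub_eq_add_neg]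
      · refine ⟨y, -z, -x, by linarith, (hsign2 _ _ _ (by linarith)).trans
          ((hsign3 _ _ _ hu).trans (hcyc _ _ _ hs')), ?_⟩
        rwa [mul_neg, mul_neg, ← sub_eq_add_neg, ← sub_eq_add_neg]
    obtain ⟨t, ht, ht1, ht2⟩ := exists_quarterTurn hs ((hunit _ _ _).1 hx')
    have h5 := hf.add_quarterTurn hs hmax ((hunit _ _ _).1 hx') ht ht1 ht2
    rw [inner_cylPoint, hfx'] at h5
    obtain ⟨⟨t₁, t₂⟩, t₃, rfl⟩ := exists_eq_cylPoint t
    have ht' := (hunit _ _ _).2 ht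
    have h6 := h0 _ _ _ ht'
    have h7 := hmax _ (hpos t₁ (-t₃) t₂ (by linarith))
    have h8 : (x * y' + y * z' + z * x') ^ 2 ≤ 1 / 4 := by
      rw [← sq_abs]
      nlinarith [abs_nonneg (x * y' + y * z' + z * x')]
    simp only at h5
    nlinarith
  have h3 := (hmax _ (hpos a b c h)).trans hM
  have h4 := (hmax _ (hpos a (-c) b (by linarith))).trans hM
  linarith [h0 a b c h]

/-- Let `q` be the form with the same values on the axes. `add_quarterTurn` at the maximum of `f`,
and at the maximum of `-f`, shows that `f` and `q` have equal sums over a point and its quarter turn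
about the first and third axes. Thus `f - q` satisfies `eq_zero_of_antisymm`. -/
theorem eq_of_extremal (hf : IsFrameFunction f w) {C : ℝ} (hC : ∀ x, |f x| ≤ C)
    (hmax : ∀ x, x ≠ 0 → f x ≤ f (cylPoint 1 0)) (hmin : ∀ x, x ≠ 0 → f (cylPoint 0 1) ≤ f x)
    {a b c : ℝ} (h : a ^ 2 + b ^ 2 + c ^ 2 = 1) :
    f (cylPoint ⟨a, b⟩ c) = f (cylPoint 1 0) * a ^ 2 + f (cylPoint Complex.I 0) * b ^ 2 +
      f (cylPoint 0 1) * c ^ 2 := by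
  obtain ⟨α, hα⟩ : ∃ α, α = f (cylPoint 1 0) := ⟨_, rfl⟩
  obtain ⟨β, hβ⟩ : ∃ β, β = f (cylPoint Complex.I 0) := ⟨_, rfl⟩
  obtain ⟨γ, hγ⟩ : ∃ γ, γ = f (cylPoint 0 1) := ⟨_, rfl⟩
  have hw : α + β + γ = w := by
    rw [hα, hβ, hγ]
    exact hf.sum_eq _ _ _ (cylPoint_ne_zero_left one_ne_zero _)
      (cylPoint_ne_zero_left Complex.I_ne_zero _) (cylPoint_ne_zero_right _ one_ne_zero)
      (by simp [inner_cylPoint]) (by simp [inner_cylPoint]) (by simp [inner_cylPoint])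
  have hunit : ∀ a b c : ℝ, a ^ 2 + b ^ 2 + c ^ 2 = 1 → ‖cylPoint ⟨a, b⟩ c‖ = 1 := by
    intro a b c h
    rw [← sq_eq_sq₀ (norm_nonneg _) zero_le_one, norm_sq_cylPoint, Complex.normSq_apply]
    linarith
  obtain ⟨q, hq⟩ : ∃ q : EuclideanSpace ℝ (Fin 3) → ℝ,
    q = fun x => (α * x 0 ^ 2 + β * x 1 ^ 2 + γ * x 2 ^ 2) / ‖x‖ ^ 2 := ⟨_, rfl⟩
  have hqu : ∀ a b c : ℝ, a ^ 2 + b ^ 2 + c ^ 2 = 1 →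
      q (cylPoint ⟨a, b⟩ c) = α * a ^ 2 + β * b ^ 2 + γ * c ^ 2 := by
    intro a b c h
    simp only [hq]
    rw [hunit a b c h]
    simp [cylPoint]
  have hqC : ∀ x, |q x| ≤ 3 * C := by
    intro x
    have hC0 : 0 ≤ C := (abs_nonneg _).trans (hC 0)
    simp only [hq]
    rw [abs_div, abs_of_nonneg (sq_nonneg ‖x‖)]
    apply div_le_of_le_mul₀ (sq_nonneg _) (by positivity)
    have hn : ‖x‖ ^ 2 = x 0 ^ 2 + x 1 ^ 2 + x 2 ^ 2 := by
      rw [EuclideanSpace.norm_sq_eq]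
      simp [Fin.sum_univ_three]
    have e : ∀ (i : Fin 3) (κ : ℝ), |κ| ≤ C → |κ * x i ^ 2| ≤ C * ‖x‖ ^ 2 := by
      intro i κ hκ
      rw [abs_mul, abs_of_nonneg (sq_nonneg (x i))]
      apply mul_le_mul hκ _ (sq_nonneg _) hC0
      rw [hn]
      fin_cases i <;> simp <;> linarith [sq_nonneg (x 0), sq_nonneg (x 1), sq_nonneg (x 2)]
    have h1 := e 0 α (hα ▸ hC _)
    have h2 := e 1 β (hβ ▸ hC _)
    have h3 := e 2 γ (hγ ▸ hC _)
    linarith [abs_add_three (α * x 0 ^ 2) (β * x 1 ^ 2) (γ * x 2 ^ 2)]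
  have hframe : IsFrameFunction (fun x => f x - q x) 0 := by
    refine ⟨fun t ht x => ?_, fun a b c ha hb hc hab hac hbc => ?_⟩
    · rw [hf.smul t ht]
      simp only [hq, norm_smul, PiLp.smul_apply, smul_eq_mul, mul_pow, Real.norm_eq_abs, sq_abs]
      rw [← mul_div_mul_left _ (‖x‖ ^ 2) (pow_ne_zero 2 ht)]
      ring_nf
    · have h0 := hf.sum_eq a b c ha hb hc hab hac hbc
      have e := sum_sq_coord_div_eq_one ha hb hc hab hac hbc
      simp only [hq, add_div, mul_div_assoc]
      linear_combination h0 - hw - α * e 0 - β * e 1 - γ * e 2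
  have key := hframe.eq_zero_of_antisymm (C := C + 3 * C)
    (fun x => (abs_sub _ _).trans (add_le_add (hC x) (hqC x))) ?_ ?_ h
  · rw [hqu a b c h, sub_eq_zero] at key
    rw [key, hα, hβ, hγ]
  · intro a b c h
    have h' : a ^ 2 + (-c) ^ 2 + b ^ 2 = 1 := by linarith
    have h1 := hf.add_quarterTurn (p := cylPoint 1 0) (hunit 1 0 0 (by norm_num)) hmax
      (hunit a b c h) (hunit a (-c) b h') (by simp [inner_cylPoint])
      (by simp [inner_cylPoint]; ring)
    rw [inner_cylPoint, ← hα] at h1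
    rw [hqu _ _ _ h, hqu _ _ _ h']
    simp at h1
    linear_combination h1 - (β + γ) * h + (a ^ 2 - 1) * hw
  · intro a b c h
    have h' : (-b) ^ 2 + a ^ 2 + c ^ 2 = 1 := by linarith
    have h1 := hf.neg.add_quarterTurn (p := cylPoint 0 1) (hunit 0 0 1 (by norm_num))
      (fun x hx => neg_le_neg (hmin x hx))
      (hunit a b c h) (hunit (-b) a c h') (by simp [inner_cylPoint])
      (by simp [inner_cylPoint]; ring)
    rw [inner_cylPoint, ← hγ] at h1
    rw [hqu _ _ _ h, hqu _ _ _ h']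
    simp at h1
    linear_combination -h1 - (α + β) * h + (c ^ 2 - 1) * hw

/-- With `p` as pole, two frames sharing a horizontal axis give `f s + f s' = f p + f r`, where `s'`
is orthogonal to `s` on its meridian and `r` is the equatorial point of that meridian. Since `f s' ≤
f p`, moving from `s` to `r` does not raise the value. -/
theorem exists_min_orthogonal (hf : IsFrameFunction f w) {p s : EuclideanSpace ℝ (Fin 3)}
    (hp : ‖p‖ = 1) (hs : ‖s‖ = 1) (hmax : ∀ x, x ≠ 0 → f x ≤ f p) :
    ∃ r, ‖r‖ = 1 ∧ ⟪p, r⟫ = 0 ∧ f r ≤ f s := by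
  obtain ⟨J, rfl⟩ := exists_isometry_pole hp
  obtain ⟨s, rfl⟩ := J.surjective s
  obtain ⟨ζ, z, rfl⟩ := exists_eq_cylPoint s
  have hfJ := hf.comp J
  have hMJ : ∀ x, x ≠ 0 → f (J x) ≤ f (J (cylPoint 0 1)) := fun x hx => hmax _ (by simpa)
  suffices H : ∃ ξ : ℂ, ξ ≠ 0 ∧ f (J (cylPoint ξ 0)) ≤ f (J (cylPoint ζ z)) by
    obtain ⟨ξ, hξ, hle⟩ := H
    have h0 : J (cylPoint ξ 0) ≠ 0 := by simpa using cylPoint_ne_zero_left hξ 0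
    refine ⟨‖J (cylPoint ξ 0)‖⁻¹ • J (cylPoint ξ 0), norm_smul_inv_norm h0, ?_, ?_⟩
    · rw [inner_smul_right, J.inner_map_map, inner_cylPoint]
      simp
    · rwa [hf.smul _ (inv_ne_zero (norm_ne_zero_iff.2 h0))]
  by_cases hζ : ζ = 0
  · subst hζ
    refine ⟨1, one_ne_zero, ?_⟩
    have hz : z ≠ 0 := by
      rintro rfl
      have h0 : cylPoint 0 0 = 0 := by ext i; fin_cases i <;> simp [cylPoint]
      simp [h0] at hs
    have h1 := hfJ.smul z hz (cylPoint 0 1)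
    rw [smul_cylPoint, mul_zero, mul_one] at h1
    rw [h1]
    exact hMJ _ (cylPoint_ne_zero_left one_ne_zero _)
  · have hI := mul_ne_zero Complex.I_ne_zero hζ
    have h1 := hfJ.sum_eq (cylPoint ζ z) (cylPoint (-(z * ζ)) (Complex.normSq ζ))
      (cylPoint (Complex.I * ζ) 0) (cylPoint_ne_zero_left hζ _)
      (cylPoint_ne_zero_right _ (Complex.normSq_pos.2 hζ).ne') (cylPoint_ne_zero_left hI _)
      (by simp [inner_cylPoint, Complex.normSq_apply]; ring)
      (by simp [inner_cylPoint]; ring) (by simp [inner_cylPoint]; ring)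
    have h2 := hfJ.sum_eq (cylPoint 0 1) (cylPoint ζ 0) (cylPoint (Complex.I * ζ) 0)
      (cylPoint_ne_zero_right _ one_ne_zero) (cylPoint_ne_zero_left hζ _)
      (cylPoint_ne_zero_left hI _)
      (by simp [inner_cylPoint]) (by simp [inner_cylPoint]) (by simp [inner_cylPoint]; ring)
    exact ⟨ζ, hζ, by
      linarith [hMJ _ (cylPoint_ne_zero_right (-(z * ζ)) (Complex.normSq_pos.2 hζ).ne')]⟩

/-- Gleason's theorem in `ℝ³`: a bounded frame function is a quadratic form on the unit sphere. -/
theorem exists_quadratic (hf : IsFrameFunction f w) {C : ℝ} (hC : ∀ x, |f x| ≤ C) :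
    ∃ (b : OrthonormalBasis (Fin 3) ℝ (EuclideanSpace ℝ (Fin 3))) (κ : Fin 3 → ℝ),
      ∀ x, ‖x‖ = 1 → f x = ∑ j, κ j * ⟪b j, x⟫ ^ 2 := by
  obtain ⟨p, hp, hmax⟩ := hf.exists_max hC
  obtain ⟨s, hs, hmin⟩ := hf.neg.exists_max (C := C) (fun x => by rw [abs_neg]; exact hC x)
  obtain ⟨r, hr, hpr, hrs⟩ := hf.exists_min_orthogonal hp hs hmax
  have hon : Orthonormal ℝ (({0, 2} : Set (Fin 3)).domRestrict (![p, 0, r])) := by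
    constructor
    · rintro ⟨i, rfl | rfl⟩ <;> simpa
    · rintro ⟨i, rfl | rfl⟩ ⟨j, rfl | rfl⟩ hij
      · exact absurd rfl hij
      · exact hpr
      · exact (real_inner_comm _ _).trans hpr
      · exact absurd rfl hij
  obtain ⟨b, hb⟩ := Orthonormal.exists_orthonormalBasis_extension_of_card_eq (𝕜 := ℝ)
    (ι := Fin 3) (by simp) hon
  have hb0 : b 0 = p := hb 0 (by simp)
  have hb2 : b 2 = r := hb 2 (by simp)
  obtain ⟨J, hJ⟩ : ∃ J, J = b.repr.symm := ⟨_, rfl⟩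
  have hJ0 : J (cylPoint 1 0) = p := by
    have : cylPoint 1 0 = EuclideanSpace.single (0 : Fin 3) (1 : ℝ) := by
      ext i
      fin_cases i <;> simp [cylPoint]
    rw [hJ, this, b.repr_symm_single, hb0]
  have hJ2 : J (cylPoint 0 1) = r := by
    have : cylPoint 0 1 = EuclideanSpace.single (2 : Fin 3) (1 : ℝ) := by
      ext i
      fin_cases i <;> simp [cylPoint]
    rw [hJ, this, b.repr_symm_single, hb2]
  refine ⟨b, ![f (J (cylPoint 1 0)), f (J (cylPoint Complex.I 0)), f (J (cylPoint 0 1))],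
    fun x hx => ?_⟩
  have hx' : x = J (cylPoint ⟨⟪b 0, x⟫, ⟪b 1, x⟫⟩ ⟪b 2, x⟫) := by
    rw [hJ, LinearIsometryEquiv.eq_symm_apply]
    ext i
    fin_cases i <;> simp [cylPoint, b.repr_apply_apply]
  have hn : ⟪b 0, x⟫ ^ 2 + ⟪b 1, x⟫ ^ 2 + ⟪b 2, x⟫ ^ 2 = 1 := by
    have := b.sum_sq_norm_inner_right x
    simpa [Fin.sum_univ_three, hx] using this
  have h1 := (hf.comp J).eq_of_extremal (fun x => hC _) (fun x hx => by
    rw [hJ0]; exact hmax _ (by simpa)) (fun x hx => by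
    rw [hJ2]
    have := hmin (J x) (by simpa)
    linarith) hn
  rw [← hx'] at h1
  rw [h1]
  simp [Fin.sum_univ_three]

end IsFrameFunction

end

/-! ### Ray functions on complex planes -/

section

open scoped InnerProductSpace ComplexConjugate

/-- A bounded function on the rays of a complex Hilbert space whose sum over an orthonormal triple
depends only on the subspace spanned by it. -/
structure IsRayFunction {H : Type*} [NormedAddCommGroup H] [InnerProductSpace ℂ H]
    (f : H → ℝ) : Prop where
  smul : ∀ c : ℂ, c ≠ 0 → ∀ x, f (c • x) = f x
  bounded : ∃ C, ∀ x, |f x| ≤ C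
  sum_eq : ∀ e : Fin 3 → H, Orthonormal ℂ e → ∃ w, ∀ v : Fin 3 → H, Orthonormal ℂ v →
    (∀ i, v i ∈ Submodule.span ℂ (Set.range e)) → ∑ i, f (v i) = w

namespace IsRayFunction

section

variable {H : Type*} [NormedAddCommGroup H] [InnerProductSpace ℂ H] {f : H → ℝ}

theorem normSq_mul (hf : IsRayFunction f) (c : ℂ) (x : H) :
    ‖c • x‖ ^ 2 * f (c • x) = Complex.normSq c * (‖x‖ ^ 2 * f x) := by
  by_cases hc : c = 0
  · simp [hc]
  · rw [hf.smul c hc, norm_smul, Complex.normSq_eq_norm_sq]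
    ring

/-- The real span of a complex orthonormal triple is an isometric copy of `ℝ³`, on which `f` is a
frame function. The vector `e 2` only provides the third dimension. -/
theorem exists_real_plane (hf : IsRayFunction f) {e : Fin 3 → H} (he : Orthonormal ℂ e) :
    ∃ B : ℝ, ∀ a b : ℝ, ‖(a : ℂ) • e 0 + (b : ℂ) • e 1‖ ^ 2 * f ((a : ℂ) • e 0 + (b : ℂ) • e 1) =
      a ^ 2 * f (e 0) + b ^ 2 * f (e 1) + 2 * (a * b) * B := by
  obtain ⟨C, hC⟩ := hf.bounded
  obtain ⟨w, hw⟩ := hf.sum_eq e he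
  obtain ⟨J, hJ⟩ : ∃ J : EuclideanSpace ℝ (Fin 3) → H, J = fun x => ∑ i, (x i : ℂ) • e i := ⟨_, rfl⟩
  have hJs : ∀ (t : ℝ) x, J (t • x) = (t : ℂ) • J x := by
    intro t x
    simp [hJ, Finset.smul_sum, mul_smul]
  have hJi : ∀ x y, ⟪J x, J y⟫_ℂ = (⟪x, y⟫_ℝ : ℝ) := by
    intro x y
    simp only [hJ]
    rw [he.inner_sum]
    simp [PiLp.inner_apply, mul_comm]
  have hJn : ∀ x, ‖J x‖ = ‖x‖ := by
    intro x
    rw [← sq_eq_sq₀ (norm_nonneg _) (norm_nonneg _)]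
    have := congrArg Complex.re (hJi x x)
    rw [Complex.ofReal_re, real_inner_self_eq_norm_sq] at this
    exact (inner_self_eq_norm_sq (𝕜 := ℂ) (J x)).symm.trans this
  have hJm : ∀ x, J x ∈ Submodule.span ℂ (Set.range e) := by
    intro x
    simp only [hJ]
    exact Submodule.sum_mem _ fun i _ =>
      Submodule.smul_mem _ _ (Submodule.subset_span (Set.mem_range_self i))
  have hframe : IsFrameFunction (fun x => f (J x)) w := by
    refine ⟨fun t ht x => ?_, fun a b c ha hb hc hab hac hbc => ?_⟩
    · rw [hJs, hf.smul _ (by exact_mod_cast ht)]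
    · have hn : ∀ x : EuclideanSpace ℝ (Fin 3), x ≠ 0 →
          ‖J (‖x‖⁻¹ • x)‖ = 1 ∧ f (J (‖x‖⁻¹ • x)) = f (J x) := by
        intro x hx
        refine ⟨(hJn _).trans (norm_smul_inv_norm hx), ?_⟩
        rw [hJs, hf.smul]
        exact_mod_cast inv_ne_zero (norm_ne_zero_iff.2 hx)
      have ho : ∀ x y : EuclideanSpace ℝ (Fin 3), ⟪x, y⟫_ℝ = 0 →
          ⟪J (‖x‖⁻¹ • x), J (‖y‖⁻¹ • y)⟫_ℂ = 0 := by
        intro x y hxy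
        rw [hJi, inner_smul_left, inner_smul_right, hxy]
        simp
      have h1 := hw ![J (‖a‖⁻¹ • a), J (‖b‖⁻¹ • b), J (‖c‖⁻¹ • c)] (by
          constructor
          · intro i
            fin_cases i
            · exact (hn a ha).1
            · exact (hn b hb).1
            · exact (hn c hc).1
          · intro i j hij
            fin_cases i <;> fin_cases j
            · exact absurd rfl hij
            · exact ho a b hab
            · exact ho a c hac
            · exact ho b a ((real_inner_comm _ _).trans hab)
            · exact absurd rfl hij
            · exact ho b c hbc
            · exact ho c a ((real_inner_comm _ _).trans hac)
            · exact ho c b ((real_inner_comm _ _).trans hbc)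
            · exact absurd rfl hij) (by
          intro i
          fin_cases i <;> exact hJm _)
      simp only [Fin.sum_univ_three, Matrix.cons_val_zero, Matrix.cons_val_one,
        Matrix.cons_val] at h1
      rwa [(hn a ha).2, (hn b hb).2, (hn c hc).2] at h1
  obtain ⟨b, κ, hκ⟩ := hframe.exists_quadratic (fun x => hC (J x))
  have hq : ∀ x, ‖x‖ ^ 2 * f (J x) = ∑ j, κ j * ⟪b j, x⟫_ℝ ^ 2 := by
    intro x
    by_cases hx : x = 0
    · simp [hx]
    · have h1 := hκ (‖x‖⁻¹ • x) (norm_smul_inv_norm hx)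
      rw [hJs, hf.smul _ (by exact_mod_cast inv_ne_zero (norm_ne_zero_iff.2 hx))] at h1
      rw [h1, Finset.mul_sum]
      refine Finset.sum_congr rfl fun j _ => ?_
      rw [inner_smul_right]
      have := norm_ne_zero_iff.2 hx
      field_simp
  have h0 : J (EuclideanSpace.single 0 1) = e 0 := by simp [hJ, Fin.sum_univ_three]
  have h1 : J (EuclideanSpace.single 1 1) = e 1 := by simp [hJ, Fin.sum_univ_three]
  have q0 := hq (EuclideanSpace.single 0 1)
  have q1 := hq (EuclideanSpace.single 1 1)
  refine ⟨∑ j, κ j * (⟪b j, EuclideanSpace.single 0 1⟫_ℝ * ⟪b j, EuclideanSpace.single 1 1⟫_ℝ),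
    fun s t => ?_⟩
  have hst := hq (s • EuclideanSpace.single 0 1 + t • EuclideanSpace.single 1 1)
  have hJst : J (s • EuclideanSpace.single 0 1 + t • EuclideanSpace.single 1 1) =
      (s : ℂ) • e 0 + (t : ℂ) • e 1 := by
    simp [hJ, Fin.sum_univ_three]
  rw [h0] at q0
  rw [h1] at q1
  simp only [PiLp.norm_single, norm_one, one_pow, one_mul] at q0 q1
  rw [← hJst, hJn, hst, q0, q1]
  simp only [Finset.mul_sum, ← Finset.sum_add_distrib]
  refine Finset.sum_congr rfl fun j _ => ?_
  rw [inner_add_right, inner_smul_right, inner_smul_right]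
  ring

theorem orthonormal_triple {x y z : H} (hx : ‖x‖ = 1) (hy : ‖y‖ = 1) (hz : ‖z‖ = 1)
    (hxy : ⟪x, y⟫_ℂ = 0) (hxz : ⟪x, z⟫_ℂ = 0) (hyz : ⟪y, z⟫_ℂ = 0) :
    Orthonormal ℂ ![x, y, z] := by
  constructor
  · intro i
    fin_cases i <;> assumption
  · intro i j hij
    fin_cases i <;> fin_cases j
    · exact absurd rfl hij
    · exact hxy
    · exact hxz
    · exact inner_eq_zero_symm.1 hxy
    · exact absurd rfl hij
    · exact hyz
    · exact inner_eq_zero_symm.1 hxz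
    · exact inner_eq_zero_symm.1 hyz
    · exact absurd rfl hij

/-- For each phase `z`, the real plane of `e 0` and `z • e 1` gives a cross coefficient `B`, whose
dependence on `z` must be shown to be real linear. The real plane of `u` and `i v`, with `u, v = (e
0 ± e 1) / √2`, contains all `w • e 0 + conj w • e 1`. For `s² = z` and `w = conj s` this vector is
`conj s • (e 0 + z • e 1)`, so `B` is a quadratic form in `s` that becomes linear in `z`. -/
theorem exists_complex_plane (hf : IsRayFunction f) {e : Fin 3 → H} (he : Orthonormal ℂ e) :
    ∃ D E : ℝ, ∀ a b : ℂ, ‖a • e 0 + b • e 1‖ ^ 2 * f (a • e 0 + b • e 1) =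
      Complex.normSq a * f (e 0) + Complex.normSq b * f (e 1) +
        D * (conj a * b).re + E * (conj a * b).im := by
  have n0 := he.1 0
  have n1 := he.1 1
  have n2 := he.1 2
  have o01 := he.2 (show (0 : Fin 3) ≠ 1 by decide)
  have o02 := he.2 (show (0 : Fin 3) ≠ 2 by decide)
  have o12 := he.2 (show (1 : Fin 3) ≠ 2 by decide)
  have o10 := he.2 (show (1 : Fin 3) ≠ 0 by decide)
  obtain ⟨q, hq⟩ : ∃ q : H → ℝ, q = fun x => ‖x‖ ^ 2 * f x := ⟨_, rfl⟩
  have hqs : ∀ (c : ℂ) x, q (c • x) = Complex.normSq c * q x := by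
    intro c x
    rw [hq]
    exact hf.normSq_mul c x
  have hqu : ∀ x, ‖x‖ = 1 → q x = f x := fun x hx => by simp [hq, hx]
  have hphase : ∀ z : ℂ, ‖z‖ = 1 → ∃ B : ℝ, ∀ a b : ℝ, q ((a : ℂ) • e 0 + (b : ℂ) • z • e 1) =
      a ^ 2 * f (e 0) + b ^ 2 * f (e 1) + 2 * (a * b) * B := by
    intro z hz
    obtain ⟨B, hB⟩ := hf.exists_real_plane (e := ![e 0, z • e 1, e 2])
      (orthonormal_triple n0 (by rw [norm_smul, hz, n1, one_mul]) n2
        (by rw [inner_smul_right, o01, mul_zero]) o02 (by rw [inner_smul_left, o12, mul_zero]))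
    refine ⟨B, fun a b => ?_⟩
    have := hB a b
    simp only [Matrix.cons_val_zero, Matrix.cons_val_one] at this
    rw [hf.smul z (by rintro rfl; simp at hz)] at this
    rw [hq]
    exact this
  obtain ⟨r, hr⟩ : ∃ r : ℝ, r = (√2)⁻¹ := ⟨_, rfl⟩
  have hr2 : r ^ 2 = 1 / 2 := by rw [hr, inv_pow, Real.sq_sqrt (by norm_num)]; norm_num
  have hr2' : (r : ℂ) * r = 1 / 2 := by
    rw [← Complex.ofReal_mul, ← sq, hr2]
    norm_num
  obtain ⟨u, hu⟩ : ∃ u, u = (r : ℂ) • e 0 + (r : ℂ) • e 1 := ⟨_, rfl⟩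
  obtain ⟨v, hv⟩ : ∃ v, v = (r : ℂ) • e 0 + (-r : ℂ) • e 1 := ⟨_, rfl⟩
  have hin : ∀ a b c d : ℂ, ⟪a • e 0 + b • e 1, c • e 0 + d • e 1⟫_ℂ = conj a * c + conj b * d := by
    intro a b c d
    simp only [inner_add_left, inner_add_right, inner_smul_left, inner_smul_right, o01, o10,
      inner_self_eq_norm_sq_to_K, n0, n1]
    simp
    ring
  have hin2 : ∀ a b : ℂ, ⟪a • e 0 + b • e 1, e 2⟫_ℂ = 0 := by
    intro a b
    simp only [inner_add_left, inner_smul_left, o02, o12, mul_zero, add_zero]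
  have nu : ‖u‖ = 1 := by
    rw [← sq_eq_sq₀ (norm_nonneg _) zero_le_one, ← inner_self_eq_norm_sq (𝕜 := ℂ), hu, hin]
    simp
    linarith
  have nv : ‖v‖ = 1 := by
    rw [← sq_eq_sq₀ (norm_nonneg _) zero_le_one, ← inner_self_eq_norm_sq (𝕜 := ℂ), hv, hin]
    simp
    linarith
  have ouv : ⟪u, v⟫_ℂ = 0 := by
    rw [hu, hv, hin]
    simp
  have ou2 : ⟪u, e 2⟫_ℂ = 0 := hu ▸ hin2 _ _
  have ov2 : ⟪v, e 2⟫_ℂ = 0 := hv ▸ hin2 _ _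
  obtain ⟨G, hG⟩ := hf.exists_real_plane (e := ![u, Complex.I • v, e 2])
    (orthonormal_triple nu (by simp [norm_smul, nv]) n2
      (by rw [inner_smul_right, ouv, mul_zero]) ou2 (by rw [inner_smul_left, ov2, mul_zero]))
  simp only [Matrix.cons_val_zero, Matrix.cons_val_one] at hG
  rw [hf.smul _ Complex.I_ne_zero] at hG
  have hconj : ∀ w : ℂ, q (w • e 0 + conj w • e 1) =
      2 * (w.re ^ 2 * f u + w.im ^ 2 * f v + 2 * (w.re * w.im) * G) := by
    intro w
    rw [← hG w.re w.im]
    have h1 : w • e 0 + conj w • e 1 =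
        (2 * r : ℂ) • ((w.re : ℂ) • u + (w.im : ℂ) • Complex.I • v) := by
      rw [hu, hv]
      simp only [smul_add, smul_smul, add_add_add_comm _ _ (_ • e 0) _, ← add_smul]
      congr 2
      · conv_lhs => rw [← Complex.re_add_im w]
        linear_combination -2 * (w.re + w.im * Complex.I) * hr2'
      · conv_lhs => rw [← Complex.re_add_im w]
        rw [map_add, map_mul, Complex.conj_ofReal, Complex.conj_ofReal, Complex.conj_I]
        linear_combination -2 * (w.re - w.im * Complex.I) * hr2'
    rw [h1, hqs, hq]
    congr 1
    rw [map_mul, Complex.normSq_ofReal]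
    norm_num [Complex.normSq_apply]
    linarith
  -- This removes the term of the quadratic form in `s` proportional to `|s|²`, which is not linear
  -- in `z`.
  have huv : f u + f v = f (e 0) + f (e 1) := by
    obtain ⟨B, hB⟩ := hphase 1 norm_one
    have h1 := hB r r
    have h2 := hB r (-r)
    simp only [one_smul] at h1 h2
    push_cast at h2
    rw [← hu, hqu u nu] at h1
    rw [← hv, hqu v nv] at h2
    rw [h1, h2]
    linear_combination (2 * f (e 0) + 2 * f (e 1)) * hr2
  refine ⟨f u - f v, -2 * G, fun a b => ?_⟩
  have goal_eq : ‖a • e 0 + b • e 1‖ ^ 2 * f (a • e 0 + b • e 1) = q (a • e 0 + b • e 1) := by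
    rw [hq]
  rw [goal_eq]
  by_cases ha : a = 0
  · subst ha
    rw [zero_smul, zero_add, hqs, hqu _ n1]
    simp
  by_cases hb : b = 0
  · subst hb
    rw [zero_smul, add_zero, hqs, hqu _ n0]
    simp
  have na : (‖a‖ : ℂ) ≠ 0 := by exact_mod_cast norm_ne_zero_iff.2 ha
  have nb : (‖b‖ : ℂ) ≠ 0 := by exact_mod_cast norm_ne_zero_iff.2 hb
  obtain ⟨z, hz⟩ : ∃ z, z = (b / ‖b‖) / (a / ‖a‖) := ⟨_, rfl⟩
  have nz : ‖z‖ = 1 := by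
    have h1 := norm_ne_zero_iff.2 ha
    have h2 := norm_ne_zero_iff.2 hb
    rw [hz]
    simp only [norm_div, Complex.norm_real, norm_norm]
    field_simp
  obtain ⟨B, hB⟩ := hphase z nz
  obtain ⟨s, hs⟩ := IsAlgClosed.exists_pow_nat_eq z two_pos
  have ns : ‖s‖ = 1 := by
    have : ‖s‖ ^ 2 = 1 := by rw [← norm_pow, hs, nz]
    exact (pow_eq_one_iff_of_nonneg (norm_nonneg s) two_ne_zero).1 this
  have ns2 : s.re ^ 2 + s.im ^ 2 = 1 := by
    have := Complex.normSq_eq_norm_sq s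
    rw [ns, Complex.normSq_apply] at this
    linarith
  have hss : conj s * s = 1 := by
    rw [Complex.conj_mul', ns]
    simp
  have h1 : q (a • e 0 + b • e 1) =
      ‖a‖ ^ 2 * f (e 0) + ‖b‖ ^ 2 * f (e 1) + 2 * (‖a‖ * ‖b‖) * B := by
    rw [← hB]
    have : a • e 0 + b • e 1 = (a / ‖a‖) • ((‖a‖ : ℂ) • e 0 + (‖b‖ : ℂ) • z • e 1) := by
      rw [smul_add, smul_smul, smul_smul, smul_smul, hz]
      congr 2 <;> field_simp
    rw [this, hqs, map_div₀, Complex.normSq_ofReal, Complex.normSq_eq_norm_sq, ← sq, div_self,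
      one_mul]
    exact pow_ne_zero 2 (norm_ne_zero_iff.2 ha)
  have h2 := hB 1 1
  have h3 := hconj (conj s)
  have h4 : conj s • e 0 + conj (conj s) • e 1 =
      conj s • (((1 : ℝ) : ℂ) • e 0 + ((1 : ℝ) : ℂ) • z • e 1) := by
    rw [smul_add, smul_smul, smul_smul, smul_smul, Complex.conj_conj, ← hs]
    congr 2
    · simp
    · push_cast
      linear_combination -s * hss
  rw [h4, hqs, h2, Complex.normSq_conj, Complex.normSq_eq_norm_sq, ns, Complex.conj_re,
    Complex.conj_im] at h3
  have hzre : z.re = s.re ^ 2 - s.im ^ 2 := by rw [← hs, sq, Complex.mul_re]; ring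
  have hzim : z.im = 2 * (s.re * s.im) := by rw [← hs, sq, Complex.mul_im]; ring
  have hab : conj a * b = ((‖a‖ * ‖b‖ : ℝ) : ℂ) * z := by
    have h5 : conj a * a = ‖a‖ ^ 2 := Complex.conj_mul' a
    rw [hz]
    push_cast
    field_simp
    exact h5
  have hB2 : 2 * B = (s.re ^ 2 - s.im ^ 2) * (f u - f v) - 4 * (s.re * s.im) * G := by
    linear_combination h3 + huv + (f u + f v) * ns2
  rw [h1, hab, Complex.re_ofReal_mul, Complex.im_ofReal_mul, hzre, hzim,
    Complex.normSq_eq_norm_sq, Complex.normSq_eq_norm_sq]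
  linear_combination ‖a‖ * ‖b‖ * hB2

end

end IsRayFunction

end

/-! ### Gleason's theorem in complex dimension at least three -/

section

open scoped InnerProductSpace ComplexConjugate

namespace IsRayFunction

variable {H : Type*} [NormedAddCommGroup H] [InnerProductSpace ℂ H] [FiniteDimensional ℂ H]
  {f : H → ℝ}

/-- Gram–Schmidt applied to `x, y, y, …`: the resulting basis is triangular, so `x` and `y` involve
only its first two vectors. -/
theorem exists_orthonormal_pair (hdim : 3 ≤ Module.finrank ℂ H) (x y : H) :
    ∃ e : Fin 3 → H, Orthonormal ℂ e ∧ ∃ a b c d : ℂ,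
      x = a • e 0 + b • e 1 ∧ y = c • e 0 + d • e 1 := by
  obtain ⟨m, hm⟩ := Nat.exists_eq_add_of_le' hdim
  obtain ⟨v, hv⟩ : ∃ v : Fin (m + 3) → H, v = fun i => if i = 0 then x else y := ⟨_, rfl⟩
  have hcard : Module.finrank ℂ H = Fintype.card (Fin (m + 3)) := by simpa
  obtain ⟨B, hB⟩ : ∃ B, B = InnerProductSpace.gramSchmidtOrthonormalBasis hcard v := ⟨_, rfl⟩
  have hz : ∀ i j : Fin (m + 3), i < j → ⟪B j, v i⟫_ℂ = 0 := by
    intro i j hij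
    rw [hB]
    exact InnerProductSpace.gramSchmidtOrthonormalBasis_inv_triangular hcard v hij
  have h2 : ∀ i : Fin (m + 3), i ≤ 1 → v i = ⟪B 0, v i⟫_ℂ • B 0 + ⟪B 1, v i⟫_ℂ • B 1 := by
    intro i hi
    conv_lhs => rw [← B.sum_repr' (v i)]
    rw [← Finset.sum_subset (Finset.subset_univ {0, 1}), Finset.sum_pair (by simp)]
    intro j _ hj
    rw [hz i j, zero_smul]
    apply lt_of_le_of_lt hi
    simp only [Finset.mem_insert, Finset.mem_singleton, not_or] at hj
    rw [Fin.lt_def]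
    have h0 : (j : ℕ) ≠ 0 := fun h => hj.1 (Fin.ext h)
    have h1 : (j : ℕ) ≠ 1 := fun h => hj.2 (Fin.ext (by simpa using h))
    simp
    omega
  have h3 : 3 ≤ m + 3 := by omega
  refine ⟨fun i => B (Fin.castLE h3 i), B.orthonormal.comp _ (Fin.castLE_injective h3), ?_⟩
  have hx := h2 0 (Fin.zero_le _)
  have hy := h2 1 le_rfl
  have v0 : v 0 = x := by simp [hv]
  have v1 : v 1 = y := by simp [hv]
  rw [v0] at hx
  rw [v1] at hy
  exact ⟨_, _, _, _, hx, hy⟩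

/-- A Hermitian form stays Hermitian under linear substitution; the witnesses are the real and
imaginary cross coefficients after expansion. -/
theorem exists_hermitian_plane (hf : IsRayFunction f) (hdim : 3 ≤ Module.finrank ℂ H) (x y : H) :
    ∃ D E : ℝ, ∀ a b : ℂ, ‖a • x + b • y‖ ^ 2 * f (a • x + b • y) =
      Complex.normSq a * (‖x‖ ^ 2 * f x) + Complex.normSq b * (‖y‖ ^ 2 * f y) +
        D * (conj a * b).re + E * (conj a * b).im := by
  obtain ⟨e, he, a, b, c, d, hx, hy⟩ := exists_orthonormal_pair hdim x y
  obtain ⟨D, E, h⟩ := hf.exists_complex_plane he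
  have hst : ∀ s t : ℂ, s • x + t • y = (s * a + t * c) • e 0 + (s * b + t * d) • e 1 := by
    intro s t
    rw [hx, hy]
    module
  have hx' := h a b
  have hy' := h c d
  rw [← hx] at hx'
  rw [← hy] at hy'
  refine ⟨2 * (conj a * c).re * f (e 0) + 2 * (conj b * d).re * f (e 1) +
      D * ((conj a * d).re + (b * conj c).re) + E * ((conj a * d).im + (b * conj c).im),
    -2 * (conj a * c).im * f (e 0) - 2 * (conj b * d).im * f (e 1) +
      D * ((b * conj c).im - (conj a * d).im) + E * ((conj a * d).re - (b * conj c).re),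
    fun s t => ?_⟩
  rw [hst, h, hx', hy']
  simp only [Complex.normSq_apply, Complex.mul_re, Complex.mul_im, Complex.add_re, Complex.add_im,
    Complex.conj_re, Complex.conj_im]
  ring

/-- Gleason's theorem: a ray function on a complex Hilbert space of finite dimension at least
three is given by a linear operator. -/
theorem exists_operator (hf : IsRayFunction f) (hdim : 3 ≤ Module.finrank ℂ H) :
    ∃ ρ : H →ₗ[ℂ] H, ∀ x, ⟪ρ x, x⟫_ℂ = ((‖x‖ ^ 2 * f x : ℝ) : ℂ) := by
  obtain ⟨q, hq⟩ : ∃ q : H → ℝ, q = fun x => ‖x‖ ^ 2 * f x := ⟨_, rfl⟩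
  have plane : ∀ x y, ∃ D E : ℝ, ∀ a b : ℂ, q (a • x + b • y) =
      Complex.normSq a * q x + Complex.normSq b * q y +
        D * (conj a * b).re + E * (conj a * b).im := by
    intro x y
    rw [hq]
    exact hf.exists_hermitian_plane hdim x y
  have hqs : ∀ (c : ℂ) x, q (c • x) = Complex.normSq c * q x := by
    intro c x
    rw [hq]
    exact hf.normSq_mul c x
  -- Jordan–von Neumann: the parallelogram law makes the polarization additive. Real homogeneity is
  -- read off from `plane`, so no continuity is needed.
  obtain ⟨S, hS⟩ : ∃ S : H → H → ℝ, S = fun x y => (q (x + y) - q (x - y)) / 4 := ⟨_, rfl⟩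
  have par : ∀ x y, q (x + y) + q (x - y) = 2 * q x + 2 * q y := by
    intro x y
    obtain ⟨D, E, h⟩ := plane x y
    have h1 := h 1 1
    have h2 := h 1 (-1)
    simp at h1 h2
    rw [sub_eq_add_neg, h1, h2]
    ring
  have q0 : q 0 = 0 := by simp [hq]
  have S_add : ∀ x y z, S (x + y) z = S x z + S y z := by
    have two : ∀ x y z, S (x + y) z + S (x - y) z = 2 * S x z := by
      intro x y z
      have h1 := par (x + z) y
      have h2 := par (x - z) y
      simp only [hS]
      rw [show x + y + z = x + z + y by abel, show x + y - z = x - z + y by abel,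
        show x - y + z = x + z - y by abel, show x - y - z = x - z - y by abel]
      linarith
    have zero : ∀ z, S 0 z = 0 := by
      intro z
      have := hqs (-1) z
      simp at this
      simp [hS, this]
    have dbl : ∀ x z, S (x + x) z = 2 * S x z := by
      intro x z
      have := two x x z
      rwa [sub_self, zero, add_zero] at this
    intro x y z
    have h1 := two ((1 / 2 : ℂ) • (x + y)) ((1 / 2 : ℂ) • (x - y)) z
    have h2 := dbl ((1 / 2 : ℂ) • (x + y)) z
    rw [show (1 / 2 : ℂ) • (x + y) + (1 / 2 : ℂ) • (x + y) = x + y by module] at h2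
    rw [show (1 / 2 : ℂ) • (x + y) + (1 / 2 : ℂ) • (x - y) = x by module,
      show (1 / 2 : ℂ) • (x + y) - (1 / 2 : ℂ) • (x - y) = y by module] at h1
    linarith
  have S_comm : ∀ x y, S x y = S y x := by
    intro x y
    have := hqs (-1) (x - y)
    simp at this
    simp only [hS]
    rw [add_comm, ← this]
  have S_smul : ∀ (t : ℝ) x y, S ((t : ℂ) • x) y = t * S x y := by
    intro t x y
    obtain ⟨D, E, h⟩ := plane x y
    have h1 := h t 1
    have h2 := h t (-1)
    have h3 := h 1 1
    have h4 := h 1 (-1)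
    simp only [one_smul, neg_smul, ← sub_eq_add_neg] at h1 h2 h3 h4
    simp only [hS]
    rw [h1, h2, h3, h4]
    simp
    ring
  have S_I : ∀ x y, S (Complex.I • x) (Complex.I • y) = S x y := by
    intro x y
    simp only [hS]
    rw [← smul_add, ← smul_sub, hqs, hqs]
    simp
  have S_self : ∀ x, S x x = q x := by
    intro x
    have := hqs 2 x
    rw [two_smul] at this
    simp only [hS]
    rw [this, sub_self, q0]
    norm_num [Complex.normSq_apply]
  have S_I_left : ∀ x y, S (Complex.I • x) y = -S x (Complex.I • y) := by
    intro x y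
    have h1 := S_I (Complex.I • x) y
    rw [smul_smul, Complex.I_mul_I] at h1
    have h2 := S_smul (-1) x (Complex.I • y)
    push_cast at h2
    rw [← h1, h2]
    ring
  -- The sesquilinear form with real part `S`, linear in the second argument to match the inner
  -- product, so that Riesz representation yields the operator.
  obtain ⟨B, hB⟩ : ∃ B : H → H → ℂ, B = fun x y => (S x y : ℂ) - Complex.I * S x (Complex.I • y) :=
    ⟨_, rfl⟩
  have S_add' : ∀ x y z, S x (y + z) = S x y + S x z := by
    intro x y z
    rw [S_comm, S_add, S_comm y, S_comm z]
  have S_smul' : ∀ (t : ℝ) x y, S x ((t : ℂ) • y) = t * S x y := by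
    intro t x y
    rw [S_comm, S_smul, S_comm]
  have B_add : ∀ x y z, B (x + y) z = B x z + B y z := by
    intro x y z
    simp only [hB, S_add]
    push_cast
    ring
  have B_add' : ∀ x y z, B x (y + z) = B x y + B x z := by
    intro x y z
    simp only [hB, smul_add, S_add']
    push_cast
    ring
  have B_smul' : ∀ (c : ℂ) x y, B x (c • y) = c * B x y := by
    intro c x y
    have e1 : c • y = (c.re : ℂ) • y + (c.im : ℂ) • Complex.I • y := by
      rw [smul_smul, ← add_smul, Complex.re_add_im]
    have e2 : Complex.I • c • y = (c.re : ℂ) • Complex.I • y + ((-c.im : ℝ) : ℂ) • y := by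
      conv_lhs => rw [← Complex.re_add_im c]
      rw [smul_smul, smul_smul, ← add_smul]
      congr 1
      push_cast
      linear_combination (c.im : ℂ) * Complex.I_mul_I
    simp only [hB]
    rw [e2, e1, S_add', S_add', S_smul', S_smul', S_smul', S_smul']
    conv_rhs => rw [← Complex.re_add_im c]
    push_cast
    linear_combination (c.im * S x (Complex.I • y) : ℂ) * Complex.I_mul_I
  have B_conj : ∀ x y, conj (B x y) = B y x := by
    intro x y
    simp only [hB]
    rw [map_sub, map_mul, Complex.conj_ofReal, Complex.conj_ofReal, Complex.conj_I, S_comm x y,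
      S_comm x (Complex.I • y), S_I_left]
    push_cast
    ring
  have B_smul : ∀ (c : ℂ) x y, B (c • x) y = conj c * B x y := by
    intro c x y
    rw [← B_conj, B_smul', map_mul, B_conj]
  have B_self : ∀ x, B x x = q x := by
    intro x
    have h1 := S_I_left x x
    rw [S_comm] at h1
    have h2 : S x (Complex.I • x) = 0 := by linarith
    simp [hB, h2, S_self]
  have repr : ∀ x, ∃ z : H, ∀ y, ⟪z, y⟫_ℂ = B x y := by
    intro x
    refine ⟨(InnerProductSpace.toDual ℂ H).symm (LinearMap.toContinuousLinearMap
      { toFun := B x, map_add' := B_add' x, map_smul' := fun c y => B_smul' c x y }), fun y => ?_⟩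
    rw [InnerProductSpace.toDual_symm_apply]
    rfl
  choose T hT using repr
  refine ⟨{ toFun := T, map_add' := fun x y => ?_, map_smul' := fun c x => ?_ }, fun x => ?_⟩
  · refine ext_inner_right ℂ fun z => ?_
    rw [inner_add_left, hT, hT, hT, B_add]
  · refine ext_inner_right ℂ fun z => ?_
    rw [RingHom.id_apply, inner_smul_left, hT, hT, B_smul]
  · refine (hT x x).trans ?_
    rw [B_self, hq]

end IsRayFunction

end

/-! ### The Born rule -/

section

open scoped InnerProductSpace ComplexConjugate

/-- Testing positivity on `x - s T x` gives `0 ≤ -2 s ‖T x‖² + s² K`, which fails for small `s > 0`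
unless `T x = 0`. -/
theorem LinearMap.IsPositive.apply_eq_zero {H : Type*} [NormedAddCommGroup H]
    [InnerProductSpace ℂ H] {T : H →ₗ[ℂ] H} (hT : T.IsPositive) {x : H}
    (hx : ⟪T x, x⟫_ℂ = 0) : T x = 0 := by
  obtain ⟨K, hK⟩ : ∃ K : ℝ, K = (⟪T (T x), T x⟫_ℂ).re := ⟨_, rfl⟩
  have hK0 : 0 ≤ K := hK ▸ hT.re_inner_nonneg_left (T x)
  obtain ⟨a, ha⟩ : ∃ a : ℝ, a = ‖T x‖ ^ 2 := ⟨_, rfl⟩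
  have ha0 : 0 ≤ a := ha ▸ sq_nonneg _
  have h := fun s : ℝ => hT.re_inner_nonneg_left (x - (s : ℂ) • T x)
  have h1 : ∀ s : ℝ, 0 ≤ -2 * s * a + s ^ 2 * K := by
    intro s
    have e : ⟪T (T x), x⟫_ℂ = (a : ℂ) := by
      rw [hT.isSymmetric (T x) x, inner_self_eq_norm_sq_to_K, ha]
      simp
    have e2 : ⟪T x, T x⟫_ℂ = (a : ℂ) := by
      rw [inner_self_eq_norm_sq_to_K, ha]
      simp
    have h2 := h s
    rw [map_sub, map_smul, inner_sub_left, inner_sub_right, inner_sub_right, inner_smul_left,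
      inner_smul_left, inner_smul_right, inner_smul_right, hx, e, e2] at h2
    simp only [RCLike.re_to_complex, Complex.conj_ofReal, Complex.sub_re, Complex.re_ofReal_mul,
      Complex.ofReal_re, Complex.zero_re] at h2
    rw [← hK] at h2
    linarith
  -- A value of `s` near the minimizer `a / K`; adding `1` keeps the denominator positive when `K =
  -- 0`.
  have h3 := h1 (a / (K + 1))
  have h4 : -2 * (a / (K + 1)) * a + (a / (K + 1)) ^ 2 * K = -(a ^ 2 * (K + 2)) / (K + 1) ^ 2 := by
    field_simp
    ring
  rw [h4, le_div_iff₀ (by positivity), zero_mul] at h3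
  have h5 : a = 0 := by
    by_contra h0
    have : 0 < a ^ 2 * (K + 2) := by positivity
    linarith
  rw [ha] at h5
  simpa using h5

section

variable {H : Type*} [NormedAddCommGroup H] [InnerProductSpace ℂ H] [FiniteDimensional ℂ H]

/-- The orthogonal projection onto a subspace. -/
noncomputable def subspaceProjection (U : Submodule ℂ H) : Projection H :=
  ⟨U.starProjection.toLinearMap, by
    rw [LinearMap.isStarProjection_iff_isSymmetricProjection]
    exact U.isSymmetricProjection_starProjection⟩

theorem subspaceProjection_apply (U : Submodule ℂ H) (x : H) :
    (subspaceProjection U).1 x = U.starProjection x := rfl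

theorem exists_eq_subspaceProjection (Q : Projection H) : ∃ U, Q = subspaceProjection U := by
  obtain ⟨U, _, hU⟩ := LinearMap.isSymmetricProjection_iff_eq_coe_starProjection.mp
    (LinearMap.isStarProjection_iff_isSymmetricProjection.1 Q.2)
  refine ⟨U, Subtype.ext ?_⟩
  rw [hU]
  rfl

/-- The projection onto the line spanned by a vector. -/
noncomputable def lineProjection (x : H) : Projection H := subspaceProjection (Submodule.span ℂ {x})

theorem lineProjection_smul {c : ℂ} (hc : c ≠ 0) (x : H) :
    lineProjection (c • x) = lineProjection x := by
  rw [lineProjection, Submodule.span_singleton_smul_eq (IsUnit.mk0 c hc), lineProjection]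

theorem lineProjection_apply {x : H} (hx : ‖x‖ = 1) (y : H) :
    (lineProjection x).1 y = ⟪x, y⟫_ℂ • x :=
  Submodule.starProjection_unit_singleton ℂ hx y

theorem sum_lineProjection {n : ℕ} {v : Fin n → H} (hv : Orthonormal ℂ v) :
    ∑ i, (lineProjection (v i)).1 = (subspaceProjection (Submodule.span ℂ (Set.range v))).1 := by
  ext x
  rw [subspaceProjection_apply]
  symm
  apply Submodule.eq_starProjection_of_mem_of_inner_eq_zero
  · rw [LinearMap.sum_apply]
    refine Submodule.sum_mem _ fun i _ => ?_
    rw [lineProjection_apply (hv.1 i)]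
    exact Submodule.smul_mem _ _ (Submodule.subset_span ⟨i, rfl⟩)
  · intro y hy
    induction hy using Submodule.span_induction with
    | mem y hy =>
      obtain ⟨j, rfl⟩ := hy
      rw [LinearMap.sum_apply, inner_sub_left, sum_inner, Finset.sum_eq_single j]
      · rw [lineProjection_apply (hv.1 j), inner_smul_left, inner_self_eq_norm_sq_to_K, hv.1 j]
        simp
      · intro i _ hij
        rw [lineProjection_apply (hv.1 i), inner_smul_left, hv.2 hij, mul_zero]
      · simp
    | zero => simp
    | add y z _ _ hy hz => rw [inner_add_right, hy, hz, add_zero]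
    | smul c y _ hy => rw [inner_smul_right, hy, mul_zero]

theorem lineProjection_mul_eq_zero {x y : H} (hx : ‖x‖ = 1) (hy : ‖y‖ = 1) (h : ⟪x, y⟫_ℂ = 0) :
    (lineProjection x).1 * (lineProjection y).1 = 0 := by
  ext z
  rw [Module.End.mul_apply, lineProjection_apply hy, lineProjection_apply hx, inner_smul_right, h]
  simp

theorem trace_mul_lineProjection (ρ : H →ₗ[ℂ] H) {x : H} (hx : ‖x‖ = 1) :
    LinearMap.trace ℂ H (ρ * (lineProjection x).1) = ⟪x, ρ x⟫_ℂ := by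
  rw [← InnerProductSpace.trace_rankOne]
  congr 1
  ext y
  rw [Module.End.mul_apply, lineProjection_apply hx]
  simp

theorem exists_sum_lineProjection (Q : Projection H) : ∃ (n : ℕ) (v : Fin n → H),
    Orthonormal ℂ v ∧ Q.1 = ∑ i, (lineProjection (v i)).1 := by
  obtain ⟨U, rfl⟩ := exists_eq_subspaceProjection Q
  have b := stdOrthonormalBasis ℂ U
  have hv : Orthonormal ℂ fun i => (b i : H) := b.orthonormal.comp_linearIsometry U.subtypeₗᵢ
  refine ⟨_, fun i => (b i : H), hv, Eq.trans ?_ (sum_lineProjection hv).symm⟩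
  congr 2
  have h := congrArg (Submodule.map U.subtype) b.toBasis.span_eq
  rw [Submodule.map_span, ← Set.range_comp, Submodule.map_top, Submodule.range_subtype] at h
  refine h.symm.trans ?_
  congr 2

namespace ProbabilityAssignment

variable {P : Fin 3 → Projection H}

/-- Additivity is assumed only for resolutions of the identity. Completing the family and `Q₀` by
the same `1 - Q₀` gives two resolutions to compare. -/
theorem sum_eq (p : ProbabilityAssignment P) {n : ℕ} (Q : Fin n → Projection H)
    (h : ∀ i j, i ≠ j → (Q i).1 * (Q j).1 = 0) (Q₀ : Projection H) (hQ : ∑ k, (Q k).1 = Q₀.1) :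
    ∑ k, p.prob (Q k) = p.prob Q₀ := by
  have hl : ∀ i, (Q i).1 * (1 - Q₀.1) = 0 := by
    intro i
    rw [mul_sub, mul_one, ← hQ, Finset.mul_sum, Finset.sum_eq_single i, (Q i).2.1.eq, sub_self]
    · exact fun j _ hj => h i j hj.symm
    · simp
  have hr : ∀ i, (1 - Q₀.1) * (Q i).1 = 0 := by
    intro i
    rw [sub_mul, one_mul, ← hQ, Finset.sum_mul, Finset.sum_eq_single i, (Q i).2.1.eq, sub_self]
    · exact fun j _ hj => h j i hj
    · simp
  have h1 := p.additive (n + 1) (Fin.cons ⟨1 - Q₀.1, Q₀.2.one_sub⟩ Q) (by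
    intro i j hij
    induction i using Fin.cases with
    | zero =>
      induction j using Fin.cases with
      | zero => exact absurd rfl hij
      | succ j => exact hr j
    | succ i =>
      induction j using Fin.cases with
      | zero => exact hl i
      | succ j => exact h i j fun e => hij (by rw [e])) (by
    rw [Fin.sum_univ_succ]
    simp [hQ])
  have h2 := p.additive 2 ![⟨1 - Q₀.1, Q₀.2.one_sub⟩, Q₀] (by
    intro i j hij
    fin_cases i <;> fin_cases j
    · exact absurd rfl hij
    · exact Q₀.2.one_sub_mul_self
    · exact Q₀.2.mul_one_sub_self
    · exact absurd rfl hij) (by simp [Fin.sum_univ_two])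
  rw [Fin.sum_univ_succ] at h1
  rw [Fin.sum_univ_two] at h2
  simp only [Fin.cons_zero, Fin.cons_succ, Matrix.cons_val_zero, Matrix.cons_val_one] at h1 h2
  linarith

theorem sum_line (p : ProbabilityAssignment P) {n : ℕ} {v : Fin n → H} (hv : Orthonormal ℂ v)
    {Q : Projection H} (hQ : Q.1 = ∑ i, (lineProjection (v i)).1) :
    ∑ i, p.prob (lineProjection (v i)) = p.prob Q :=
  p.sum_eq _ (fun i j hij => lineProjection_mul_eq_zero (hv.1 i) (hv.1 j) (hv.2 hij)) _ hQ.symm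

theorem isRayFunction (p : ProbabilityAssignment P) :
    IsRayFunction fun x => p.prob (lineProjection x) where
  smul c hc x := by rw [lineProjection_smul hc]
  bounded := ⟨1, fun x => by
    rw [abs_of_nonneg (p.mem_unitInterval _).1]
    exact (p.mem_unitInterval _).2⟩
  sum_eq e he := by
    refine ⟨p.prob (subspaceProjection (Submodule.span ℂ (Set.range e))), fun v hv hve => ?_⟩
    apply p.sum_line hv
    rw [sum_lineProjection hv]
    congr 2
    symm
    apply Submodule.eq_of_le_of_finrank_eq
    · rw [Submodule.span_le]
      rintro _ ⟨i, rfl⟩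
      exact hve i
    · rw [finrank_span_eq_card hv.linearIndependent, finrank_span_eq_card he.linearIndependent]

theorem ext_prob {p p' : ProbabilityAssignment P} (h : ∀ Q, p.prob Q = p'.prob Q) : p = p' := by
  cases p
  cases p'
  congr
  exact funext h

end ProbabilityAssignment

/-- Probabilities of lines fix the quadratic form of `ρ`, and over `ℂ` the quadratic form fixes the
operator; uniqueness of `ρ` rests on this. -/
theorem Represents.inner_eq {P : Fin 3 → Projection H} {ρ : H →ₗ[ℂ] H}
    {p : ProbabilityAssignment P} (h : Represents ρ p) (x : H) :
    ⟪ρ x, x⟫_ℂ = ((‖x‖ ^ 2 * p.prob (lineProjection x) : ℝ) : ℂ) := by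
  by_cases hx : x = 0
  · simp [hx]
  have hn : (‖x‖ : ℂ) ≠ 0 := by exact_mod_cast norm_ne_zero_iff.2 hx
  have hn1 : ‖(‖x‖ : ℂ)⁻¹ • x‖ = 1 := norm_smul_inv_norm hx
  have h1 := h.2 (lineProjection x)
  rw [← lineProjection_smul (inv_ne_zero hn), trace_mul_lineProjection _ hn1,
    lineProjection_smul (inv_ne_zero hn), map_smul, inner_smul_left, inner_smul_right,
    ← h.1.1.isSymmetric x x] at h1
  push_cast
  rw [h1]
  simp only [map_inv₀, Complex.conj_ofReal]
  field_simp

theorem Represents.unique {P : Fin 3 → Projection H} {ρ ρ' : H →ₗ[ℂ] H}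
    {p : ProbabilityAssignment P} (h : Represents ρ p) (h' : Represents ρ' p) : ρ = ρ' :=
  (ext_inner_map ρ ρ').1 fun x => by rw [h.inner_eq, h'.inner_eq]

theorem Represents.unique_assignment {P : Fin 3 → Projection H} {ρ : H →ₗ[ℂ] H}
    {p p' : ProbabilityAssignment P} (h : Represents ρ p) (h' : Represents ρ p') : p = p' :=
  ProbabilityAssignment.ext_prob fun Q => by
    have := (h.2 Q).trans (h'.2 Q).symm
    exact_mod_cast this

/-- Every probability assignment is given by a density operator. -/
theorem ProbabilityAssignment.exists_represents {P : Fin 3 → Projection H}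
    (hdim : 3 ≤ Module.finrank ℂ H) (p : ProbabilityAssignment P) : ∃ ρ, Represents ρ p := by
  obtain ⟨ρ, hρ⟩ := p.isRayFunction.exists_operator hdim
  have hpos : ρ.IsPositive := by
    rw [LinearMap.isPositive_iff_complex]
    intro x
    rw [hρ]
    simp only [RCLike.re_to_complex, Complex.ofReal_re, true_and]
    exact mul_nonneg (sq_nonneg ‖x‖) (p.mem_unitInterval (lineProjection x)).1
  have htr : ∀ Q : Projection H, (p.prob Q : ℂ) = LinearMap.trace ℂ H (ρ * Q.1) := by
    intro Q
    obtain ⟨n, v, hv, hQ⟩ := exists_sum_lineProjection Q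
    rw [← p.sum_line hv hQ, hQ, Finset.mul_sum, map_sum]
    push_cast
    refine Finset.sum_congr rfl fun i _ => ?_
    rw [trace_mul_lineProjection ρ (hv.1 i), ← hpos.isSymmetric, hρ, hv.1 i]
    simp
  refine ⟨ρ, ⟨hpos, ?_⟩, htr⟩
  have := htr ⟨1, IsStarProjection.one _⟩
  rw [p.normalized, mul_one] at this
  rw [← this]
  simp

end

end

/-! ### Evolution, conditioning and the unique compatible framework -/

section

open scoped InnerProductSpace ComplexConjugate

section

open scoped ComplexOrder

variable {H : Type*} [NormedAddCommGroup H] [InnerProductSpace ℂ H] [FiniteDimensional ℂ H]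

/-- Any labelling is a permutation of the sector projections, whose sum is the image of `1`. -/
theorem ATRepresentation.IsSectorLabelling.sum_eq_one {R : ATRepresentation H}
    {P : Fin 3 → Projection H} (hP : R.IsSectorLabelling P) : ∑ α, (P α).1 = 1 := by
  have hS := R.isSectorLabelling_sectorProjection
  have h : ∀ α, ∃ β, P α = R.sectorProjection β := fun α => (hS.2 _).1 ((hP.2 _).2 ⟨α, rfl⟩)
  choose σ hσ using h
  have hinj : Function.Injective σ := fun α β e => hP.1 (by rw [hσ, hσ, e])
  have hbij := Finite.injective_iff_bijective.1 hinj
  calc ∑ α, (P α).1 = ∑ α, (R.sectorProjection (σ α)).1 := by simp only [← hσ]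
    _ = ∑ α, (R.sectorProjection α).1 := hbij.sum_comp fun α => (R.sectorProjection α).1
    _ = 1 := by
      simp only [ATRepresentation.sectorProjection]
      rw [← map_sum, sum_summandUnit, map_one]

theorem LinearMap.IsPositive.trace_mul_projection_nonneg {ρ : H →ₗ[ℂ] H} (hρ : ρ.IsPositive)
    (Q : Projection H) : 0 ≤ LinearMap.trace ℂ H (ρ * Q.1) := by
  have h1 := (hρ.conj_adjoint Q.1).trace_nonneg
  rw [← LinearMap.star_eq_adjoint, Q.2.2.star_eq] at h1
  have h2 : LinearMap.trace ℂ H (Q.1 * (ρ * Q.1)) = LinearMap.trace ℂ H (ρ * Q.1) := by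
    rw [LinearMap.trace_mul_comm, mul_assoc, Q.2.1.eq]
  rw [← h2]
  exact h1

/-- The inducing valuation is `V f = ∑ α, f α Tr(ρ P_α)`; it is normalized because the `P α` sum to
`1`. -/
theorem IsDensityOperator.exists_represents {P : Fin 3 → Projection H} (hP : ∑ α, (P α).1 = 1)
    {ρ : H →ₗ[ℂ] H} (hρ : IsDensityOperator ρ) : ∃ p : ProbabilityAssignment P, Represents ρ p := by
  have h0 := fun Q => Complex.nonneg_iff.1 (hρ.1.trace_mul_projection_nonneg Q)
  have hone : (LinearMap.trace ℂ H (ρ * 1)).re = 1 := by simp [hρ.2]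
  refine ⟨{ prob := fun Q => (LinearMap.trace ℂ H (ρ * Q.1)).re
            mem_unitInterval := fun Q => ⟨(h0 Q).1, ?_⟩
            normalized := hone
            additive := fun n Q _ hQ => ?_
            extends_valuation := ?_ }, hρ, fun Q => ?_⟩
  · have := (h0 ⟨1 - Q.1, Q.2.one_sub⟩).1
    simp only [mul_sub, map_sub, Complex.sub_re] at this
    linarith
  · simp only
    rw [← hQ, Finset.mul_sum, map_sum, Complex.re_sum]
  · refine ⟨fun f => ∑ α, f α * (LinearMap.trace ℂ H (ρ * (P α).1)).re, ⟨?_, ?_, ?_⟩, ?_⟩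
    · intro a b f g
      simp only [Pi.add_apply, Pi.smul_apply, smul_eq_mul, Finset.mul_sum,
        ← Finset.sum_add_distrib]
      exact Finset.sum_congr rfl fun α _ => by ring
    · exact fun f hf => Finset.sum_nonneg fun α _ => mul_nonneg (hf α) (h0 (P α)).1
    · simp only [one_mul]
      rw [← Complex.re_sum, ← map_sum, ← Finset.mul_sum, hP, hone]
    · intro S E hE
      simp only [hE, Finset.mul_sum, map_sum, Complex.re_sum]
      refine Finset.sum_congr rfl fun α _ => ?_
      rw [Finset.sum_eq_single α]
      · simp
      · intro β _ hβ
        simp [Pi.single_eq_of_ne hβ]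
      · simp
  · exact Complex.ext rfl (h0 Q).2

theorem IsDensityOperator.conj_unitary {ρ : H →ₗ[ℂ] H} (h : IsDensityOperator ρ)
    (U : unitary (H →ₗ[ℂ] H)) :
    IsDensityOperator ((U : H →ₗ[ℂ] H) * ρ * star (U : H →ₗ[ℂ] H)) := by
  refine ⟨?_, ?_⟩
  · have := h.1.conj_adjoint (U : H →ₗ[ℂ] H)
    rwa [← LinearMap.star_eq_adjoint, ← Module.End.mul_eq_comp, ← Module.End.mul_eq_comp,
      ← mul_assoc] at this
  · rw [mul_assoc, LinearMap.trace_mul_comm, mul_assoc, Unitary.coe_star_mul_self, mul_one, h.2]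

/-- The pull-back of a projection along a unitary. -/
noncomputable def conjProjection (U : unitary (H →ₗ[ℂ] H)) (Q : Projection H) : Projection H :=
  ⟨star (U : H →ₗ[ℂ] H) * Q.1 * U, by
    constructor
    · rw [IsIdempotentElem]
      calc star (U : H →ₗ[ℂ] H) * Q.1 * U * (star (U : H →ₗ[ℂ] H) * Q.1 * U)
          = star (U : H →ₗ[ℂ] H) * Q.1 * (U * star (U : H →ₗ[ℂ] H)) * Q.1 * U := by
            simp only [mul_assoc]
        _ = star (U : H →ₗ[ℂ] H) * (Q.1 * Q.1) * U := by
            rw [Unitary.mul_star_self_of_mem U.2, mul_one]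
            simp only [mul_assoc]
        _ = _ := by rw [Q.2.1.eq]
    · rw [IsSelfAdjoint, star_mul, star_mul, star_star, Q.2.2.star_eq, mul_assoc]⟩

theorem unitary_star_apply (U : unitary (H →ₗ[ℂ] H)) (x : H) :
    star (U : H →ₗ[ℂ] H) ((U : H →ₗ[ℂ] H) x) = x := by
  rw [← Module.End.mul_apply, Unitary.coe_star_mul_self, Module.End.one_apply]

theorem unitary_apply_star (U : unitary (H →ₗ[ℂ] H)) (x : H) :
    (U : H →ₗ[ℂ] H) (star (U : H →ₗ[ℂ] H) x) = x := by
  rw [← Module.End.mul_apply, Unitary.mul_star_self_of_mem U.2, Module.End.one_apply]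

theorem conjProjection_apply_eq_iff (U : unitary (H →ₗ[ℂ] H)) (Q : Projection H) (ψ : H) :
    (conjProjection U Q).1 ψ = ψ ↔ Q.1 ((U : H →ₗ[ℂ] H) ψ) = (U : H →ₗ[ℂ] H) ψ := by
  rw [conjProjection, Module.End.mul_apply, Module.End.mul_apply]
  constructor
  · intro h
    rw [← unitary_apply_star U (Q.1 _), h]
  · intro h
    rw [h, unitary_star_apply]

/-- Inclusion of fixed spaces in both directions gives `Q' Q = Q` and `Q Q' = Q'`; the adjoint of
the second is `Q' Q = Q'`. -/
theorem eq_of_fixed_iff {Q Q' : Projection H} (h : ∀ ψ, Q.1 ψ = ψ ↔ Q'.1 ψ = ψ) : Q = Q' := by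
  have h1 : ∀ {Q Q' : Projection H}, (∀ ψ, Q.1 ψ = ψ → Q'.1 ψ = ψ) → Q'.1 * Q.1 = Q.1 := by
    intro Q Q' h
    ext ψ
    refine h (Q.1 ψ) ?_
    rw [← Module.End.mul_apply, Q.2.1.eq]
  have h2 := h1 fun ψ => (h ψ).1
  have h3 := congrArg star (h1 fun ψ => (h ψ).2)
  rw [star_mul, Q.2.2.star_eq, Q'.2.2.star_eq] at h3
  exact Subtype.ext (h2.symm.trans h3)

/-- The only event before the evolution that matches `Q` after it is `U†QU`, since fixed vectors
determine a projection. -/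
theorem isEvolved_iff {P : Fin 3 → Projection H} {U : unitary (H →ₗ[ℂ] H)}
    {p p' : ProbabilityAssignment P} :
    IsEvolved U p p' ↔ ∀ Q, p'.prob Q = p.prob (conjProjection U Q) := by
  constructor
  · exact fun h Q => h _ Q fun ψ => conjProjection_apply_eq_iff U Q ψ
  · intro h R Q hRQ
    rw [h, eq_of_fixed_iff fun ψ => (conjProjection_apply_eq_iff U Q ψ).trans (hRQ ψ).symm]

theorem isEvolved_iff_represents {P : Fin 3 → Projection H} {U : unitary (H →ₗ[ℂ] H)}
    {p p' : ProbabilityAssignment P} {ρ : H →ₗ[ℂ] H} (h : Represents ρ p) :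
    IsEvolved U p p' ↔ Represents ((U : H →ₗ[ℂ] H) * ρ * star (U : H →ₗ[ℂ] H)) p' := by
  have htr : ∀ Q : Projection H, LinearMap.trace ℂ H
      ((U : H →ₗ[ℂ] H) * ρ * star (U : H →ₗ[ℂ] H) * Q.1) = (p.prob (conjProjection U Q) : ℂ) := by
    intro Q
    rw [h.2, conjProjection, mul_assoc, mul_assoc, LinearMap.trace_mul_comm]
    simp only [mul_assoc]
  have hd := h.1.conj_unitary U
  rw [isEvolved_iff]
  constructor
  · exact fun h' => ⟨hd, fun Q => by rw [htr, h']⟩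
  · intro h' Q
    have := (h'.2 Q).trans (htr Q)
    exact_mod_cast this

theorem mul_lineProjection_of_apply_eq {Q : Projection H} {x : H} (hx : ‖x‖ = 1) {c : ℂ}
    (h : Q.1 x = c • x) : Q.1 * (lineProjection x).1 = c • (lineProjection x).1 := by
  ext y
  rw [Module.End.mul_apply, LinearMap.smul_apply, lineProjection_apply hx, map_smul, h, smul_comm]

/-- Certainty of `P α` forces `ρ' = P_α ρ' P_α`. The quadratic form of `ρ'` is then needed only on
the range of `P α`, where lines are sub-events and conditioning gives their probabilities. -/
theorem IsPosterior.represents {P : Fin 3 → Projection H} {α : Fin 3}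
    {p p' : ProbabilityAssignment P} {ρ ρ' : H →ₗ[ℂ] H} (h : Represents ρ p)
    (h' : Represents ρ' p') (hpost : IsPosterior α p p') :
    ρ' = (LinearMap.trace ℂ H (ρ * (P α).1))⁻¹ • ((P α).1 * ρ * (P α).1) := by
  have hidem : ∀ x, (P α).1 ((P α).1 x) = (P α).1 x := by
    intro x
    rw [← Module.End.mul_apply, (P α).2.1.eq]
  have hadj : ∀ x y, ⟪(P α).1 x, y⟫_ℂ = ⟪x, (P α).1 y⟫_ℂ :=
    (LinearMap.isStarProjection_iff_isSymmetricProjection.1 (P α).2).isSymmetric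
  -- A line orthogonal to `P α` has probability zero, since together they have probability at most
  -- `1`; positivity turns a vanishing expectation into `ρ' x = 0`.
  have hker : ∀ x, (P α).1 x = 0 → ρ' x = 0 := by
    intro x hx
    by_cases hx0 : x = 0
    · rw [hx0, map_zero]
    apply h'.1.1.apply_eq_zero
    have hn : (‖x‖ : ℂ) ≠ 0 := by exact_mod_cast norm_ne_zero_iff.2 hx0
    have hn1 : ‖(‖x‖ : ℂ)⁻¹ • x‖ = 1 := norm_smul_inv_norm hx0
    have h1 : (P α).1 * (lineProjection x).1 = 0 := by
      rw [← lineProjection_smul (inv_ne_zero hn), mul_lineProjection_of_apply_eq hn1 (c := 0),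
        zero_smul]
      rw [map_smul, hx, smul_zero, zero_smul]
    have h2 := congrArg star h1
    rw [star_mul, (P α).2.2.star_eq, (lineProjection x).2.2.star_eq, star_zero] at h2
    have h3 := p'.sum_eq ![P α, lineProjection x] (by
      intro i j hij
      fin_cases i <;> fin_cases j
      · exact absurd rfl hij
      · exact h1
      · exact h2
      · exact absurd rfl hij) ⟨_, (P α).2.add (lineProjection x).2 h1⟩ (by
        simp [Fin.sum_univ_two])
    rw [Fin.sum_univ_two] at h3
    simp only [Matrix.cons_val_zero, Matrix.cons_val_one] at h3
    have h4 : p'.prob (lineProjection x) = 0 := by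
      have h5 := (p'.mem_unitInterval ⟨_, (P α).2.add (lineProjection x).2 h1⟩).2
      have h6 := (p'.mem_unitInterval (lineProjection x)).1
      linarith [hpost.1]
    rw [h'.inner_eq, h4]
    simp
  have hright : ∀ x, ρ' x = ρ' ((P α).1 x) := by
    intro x
    have := hker (x - (P α).1 x) (by rw [map_sub, hidem, sub_self])
    rwa [map_sub, sub_eq_zero] at this
  refine (ext_inner_map _ _).1 fun x => ?_
  have hy : (P α).1 * (lineProjection ((P α).1 x)).1 = (lineProjection ((P α).1 x)).1 := by
    -- The line projection of the zero vector is the zero projection, so the identity holds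
    -- trivially there.
    by_cases h0 : (P α).1 x = 0
    · rw [h0, lineProjection, Submodule.span_zero_singleton]
      ext y
      rw [Module.End.mul_apply, subspaceProjection_apply]
      simp
    have hn : (‖(P α).1 x‖ : ℂ) ≠ 0 := by exact_mod_cast norm_ne_zero_iff.2 h0
    have hn1 : ‖(‖(P α).1 x‖ : ℂ)⁻¹ • (P α).1 x‖ = 1 := norm_smul_inv_norm h0
    rw [← lineProjection_smul (inv_ne_zero hn), mul_lineProjection_of_apply_eq hn1 (c := 1),
      one_smul]
    rw [map_smul, hidem, one_smul]
  have hl : ⟪ρ' x, x⟫_ℂ = ⟪ρ' ((P α).1 x), (P α).1 x⟫_ℂ := by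
    rw [h'.1.1.isSymmetric, ← hright x, hright x, ← h'.1.1.isSymmetric, ← hright x]
  rw [hl, h'.inner_eq, hpost.2 _ hy, LinearMap.smul_apply, inner_smul_left, Module.End.mul_apply,
    Module.End.mul_apply, hadj, h.inner_eq, ← h.2, ← Complex.ofReal_inv, Complex.conj_ofReal]
  push_cast
  ring

theorem isPosterior_iff_represents {P : Fin 3 → Projection H} (hdim : 3 ≤ Module.finrank ℂ H)
    {α : Fin 3} {p p' : ProbabilityAssignment P} (hp : 0 < p.prob (P α)) {ρ : H →ₗ[ℂ] H}
    (h : Represents ρ p) : IsPosterior α p p' ↔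
      Represents ((LinearMap.trace ℂ H (ρ * (P α).1))⁻¹ • ((P α).1 * ρ * (P α).1)) p' := by
  constructor
  · intro hpost
    obtain ⟨ρ', h'⟩ := p'.exists_represents hdim
    rwa [← hpost.represents h h']
  · intro h'
    have hsub : ∀ Q : Projection H, (P α).1 * Q.1 = Q.1 →
        p'.prob Q = p.prob Q / p.prob (P α) := by
      intro Q hQ
      have hQ' := congrArg star hQ
      rw [star_mul, (P α).2.2.star_eq, Q.2.2.star_eq] at hQ'
      have h1 : LinearMap.trace ℂ H ((P α).1 * ρ * (P α).1 * Q.1) =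
          LinearMap.trace ℂ H (ρ * Q.1) := by
        rw [mul_assoc, hQ, mul_assoc, LinearMap.trace_mul_comm, mul_assoc, hQ']
      have h2 := h'.2 Q
      rw [smul_mul_assoc, map_smul, h1, ← h.2, ← h.2, smul_eq_mul] at h2
      rw [div_eq_inv_mul]
      exact_mod_cast h2
    refine ⟨?_, hsub⟩
    rw [hsub _ (P α).2.1.eq, div_self hp.ne']

theorem exists_evolved {P : Fin 3 → Projection H} (hdim : 3 ≤ Module.finrank ℂ H)
    (hP : ∑ α, (P α).1 = 1) (U : unitary (H →ₗ[ℂ] H)) (p : ProbabilityAssignment P) :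
    ∃ p' : ProbabilityAssignment P, IsEvolved U p p' := by
  obtain ⟨ρ, h⟩ := p.exists_represents hdim
  have hd := h.1.conj_unitary U
  obtain ⟨p', h'⟩ := hd.exists_represents hP
  exact ⟨p', (isEvolved_iff_represents h).2 h'⟩

theorem exists_posterior {P : Fin 3 → Projection H} (hdim : 3 ≤ Module.finrank ℂ H)
    (hP : ∑ α, (P α).1 = 1) {α : Fin 3} {p : ProbabilityAssignment P} (hp : 0 < p.prob (P α)) :
    ∃ p' : ProbabilityAssignment P, IsPosterior α p p' := by
  obtain ⟨ρ, h⟩ := p.exists_represents hdim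
  have hd : IsDensityOperator
      ((LinearMap.trace ℂ H (ρ * (P α).1))⁻¹ • ((P α).1 * ρ * (P α).1)) := by
    refine ⟨LinearMap.IsPositive.smul_of_nonneg ?_ ?_, ?_⟩
    · have := h.1.1.conj_adjoint (P α).1
      rwa [← LinearMap.star_eq_adjoint, (P α).2.2.star_eq, ← Module.End.mul_eq_comp,
        ← Module.End.mul_eq_comp, ← mul_assoc] at this
    · rw [← h.2, ← Complex.ofReal_inv, Complex.zero_le_real]
      exact inv_nonneg.2 hp.le
    · have h1 : (p.prob (P α) : ℂ) ≠ 0 := by exact_mod_cast hp.ne'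
      rw [map_smul, LinearMap.trace_mul_comm _ ((P α).1 * ρ), ← mul_assoc, (P α).2.1.eq,
        LinearMap.trace_mul_comm _ (P α).1, ← h.2, smul_eq_mul, inv_mul_cancel₀ h1]
  obtain ⟨p', h'⟩ := hd.exists_represents hP
  exact ⟨p', (isPosterior_iff_represents hdim hp h).2 h'⟩

theorem InferentialFramework.isCompatible_iff {P : Fin 3 → Projection H}
    (hdim : 3 ≤ Module.finrank ℂ H) (F : InferentialFramework P) : F.IsCompatible ↔
      (∀ (U : unitary (H →ₗ[ℂ] H)) (p : ProbabilityAssignment P) (ρ : H →ₗ[ℂ] H),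
        Represents ρ p →
          Represents ((U : H →ₗ[ℂ] H) * ρ * star (U : H →ₗ[ℂ] H)) (F.evolve U p)) ∧
      (∀ (α : Fin 3) (p : ProbabilityAssignment P) (hp : 0 < p.prob (P α)) (ρ : H →ₗ[ℂ] H),
        Represents ρ p →
          Represents ((LinearMap.trace ℂ H (ρ * (P α).1))⁻¹ • ((P α).1 * ρ * (P α).1))
            (F.condition α p hp)) := by
  constructor
  · exact fun hF => ⟨fun U p ρ h => (isEvolved_iff_represents h).1 (hF.1 U p),
      fun α p hp ρ h => (isPosterior_iff_represents hdim hp h).1 (hF.2 α p hp)⟩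
  · intro hF
    refine ⟨fun U p => ?_, fun α p hp => ?_⟩
    · obtain ⟨ρ, h⟩ := p.exists_represents hdim
      exact (isEvolved_iff_represents h).2 (hF.1 U p ρ h)
    · obtain ⟨ρ, h⟩ := p.exists_represents hdim
      exact (isPosterior_iff_represents hdim hp h).2 (hF.2 α p hp ρ h)

/-- Both rules can be chosen state by state. Any two compatible choices are represented by the same
density operators, hence agree. -/
theorem InferentialFramework.existsUnique_isCompatible {P : Fin 3 → Projection H}
    (hdim : 3 ≤ Module.finrank ℂ H) (hP : ∑ α, (P α).1 = 1) :
    ∃! F : InferentialFramework P, F.IsCompatible := by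
  refine ⟨⟨fun U p => (exists_evolved hdim hP U p).choose,
    fun α p hp => (exists_posterior hdim hP hp).choose⟩,
    ⟨fun U p => (exists_evolved hdim hP U p).choose_spec,
      fun α p hp => (exists_posterior hdim hP hp).choose_spec⟩, ?_⟩
  rintro ⟨e, c⟩ hF
  rw [isCompatible_iff hdim] at hF
  congr
  · funext U p
    obtain ⟨ρ, h⟩ := p.exists_represents hdim
    exact (hF.1 U p ρ h).unique_assignment
      ((isEvolved_iff_represents h).1 (exists_evolved hdim hP U p).choose_spec)
  · funext α p hp
    obtain ⟨ρ, h⟩ := p.exists_represents hdim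
    exact (hF.2 α p hp ρ h).unique_assignment
      ((isPosterior_iff_represents hdim hp h).1 (exists_posterior hdim hP hp).choose_spec)

end

end

theorem mainTheorem11 {H : Type*} [NormedAddCommGroup H] [InnerProductSpace ℂ H]
    [FiniteDimensional ℂ H] (hdim : 3 ≤ Module.finrank ℂ H)
    (R : ATRepresentation H) (P : Fin 3 → Projection H) (hP : R.IsSectorLabelling P) :
    -- Born rule: assignments and density operators determine each other by `p(Q) = Tr(ρ Q)`
    (∀ p : ProbabilityAssignment P, ∃! ρ : H →ₗ[ℂ] H, Represents ρ p) ∧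
    (∀ ρ : H →ₗ[ℂ] H, IsDensityOperator ρ → ∃! p : ProbabilityAssignment P, Represents ρ p) ∧
    -- there is exactly one compatible framework
    (∃! F : InferentialFramework P, F.IsCompatible) ∧
    -- and it is the one with unitary conjugation and Lüders conditioning
    ∀ F : InferentialFramework P, F.IsCompatible ↔
      (∀ (U : unitary (H →ₗ[ℂ] H)) (p : ProbabilityAssignment P) (ρ : H →ₗ[ℂ] H),
        Represents ρ p →
          Represents ((U : H →ₗ[ℂ] H) * ρ * star (U : H →ₗ[ℂ] H)) (F.evolve U p)) ∧
      (∀ (α : Fin 3) (p : ProbabilityAssignment P) (hp : 0 < p.prob (P α)) (ρ : H →ₗ[ℂ] H),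
        Represents ρ p →
          Represents ((LinearMap.trace ℂ H (ρ * (P α).1))⁻¹ • ((P α).1 * ρ * (P α).1))
            (F.condition α p hp)) := by
  refine ⟨fun p => ?_, fun ρ hρ => ?_,
    InferentialFramework.existsUnique_isCompatible hdim hP.sum_eq_one,
    InferentialFramework.isCompatible_iff hdim⟩
  · obtain ⟨ρ, h⟩ := p.exists_represents hdim
    exact ⟨ρ, h, fun ρ' h' => h'.unique h⟩
  · obtain ⟨p, h⟩ := hρ.exists_represents hP.sum_eq_one
    exact ⟨p, h, fun p' h' => h'.unique_assignment h⟩
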